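/- Let $b>0$, $F(r)=1-r^{-3}-br^{-4}$, let $r_s$ be the largest positive root of $F$, let $P_x>0$ be arbitrary and $P_y=\frac{4\pi}{r_s^2F'(r_s)}$. Let $T^2=\mathbb R^2/(P_x\mathbb Z\times P_y\mathbb Z)$ with coordinates $(x,y)$, and let $M$ be the AdS-Melvin space, i.e. the solid torus covered, away from its core circle $\{r=r_s\}$, by coordinates $(r,x,y)\in(r_s,\infty)\times T^2$, with the metric $$\bar g=r^{-2}F(r)^{-1}\,dr^2+r^2\,dx^2+r^2F(r)\,dy^2 .$$ For a graph $\Sigma=\{r=s(x,y)\}$ with $s:T^2\to(r_s,\infty)$ smooth, let $\nu$ be the outward unit normal (the one with positive $\partial_r$-component), $H$ the mean curvature with respect to $\nu$ (the trace of $\bar g(\bar\nabla_\cdot\,\nu,\cdot)$), $dA$ the area form, $dV$ the volume form of $\bar g$, $\Omega=\{r<s(x,y)\}$ the region enclosed by $\Sigma$, and $$Q(\Sigma)=\int_\Sigma Hr\,dA-6\int_\Omega r\,dV .$$ Let $0<T_0\le\infty$ and let $\varphi:[0,T_0)\times T^2\to M$ be a smooth family of embeddings whose images $\Sigma_t=\varphi(t,T^2)$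 are graphs $\{r=s(t,x,y)\}$ with $s:[0,T_0)\times T^2\to(r_s,\infty)$ smooth, and which satisfies $$\frac{\partial\varphi}{\partial t}=r^{-1}\nu .$$ Then for every $t\in[0,T_0)$ the function $t\mapsto Q(\Sigma_t)$ is differentiable at $t$ (one-sidedly at $t=0$) and $$\frac{d}{dt}Q(\Sigma_t)\le 0 .$$ Moreover, for each $t$, equality holds if and only if $\Sigma_t$ is a coordinate torus $\{r\equiv\mathrm{const}\}$. -/

import Mathlib

open scoped ContDiff

noncomputable section

namespace AdSMelvin

/-! ### Coordinates

Points of the ambient space are written in coordinates `p = ![r, x, y]`, where `x` and `y` are the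
lifts to `ℝ` of the two angular coordinates, which have periods `Px` and `Py`.  Functions and maps
on the torus `T² = ℝ² / (Px ℤ × Py ℤ)` are written as functions on `ℝ²` with the corresponding
periodicity. -/

/-- The partial derivative `∂f/∂xⁱ` at `p`. -/
def pd {n : ℕ} (i : Fin n) (f : (Fin n → ℝ) → ℝ) (p : Fin n → ℝ) : ℝ :=
  fderiv ℝ f p (Pi.single i 1)

/-! ### Riemannian geometry of coordinate patches -/

/-- The Christoffel symbol `Γᶜ_{ab}` at `p` of the Levi-Civita connection of a metric `g`. -/
def christoffel {n : ℕ} (g : (Fin n → ℝ) → Matrix (Fin n) (Fin n) ℝ) (p : Fin n → ℝ)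
    (c a b : Fin n) : ℝ :=
  (1 / 2) * ∑ d, (g p)⁻¹ c d *
    (pd a (fun q => g q b d) p + pd b (fun q => g q a d) p - pd d (fun q => g q a b) p)

/-- The inner product of `v` and `w` with respect to a metric with matrix `G`. -/
def metricInner {n : ℕ} (G : Matrix (Fin n) (Fin n) ℝ) (v w : Fin n → ℝ) : ℝ :=
  ∑ a, ∑ b, G a b * v a * w b

/-- The tangent vector `∂X/∂uⁱ` of a parametrized surface `X`. -/
def tangentVec (X : (Fin 2 → ℝ) → (Fin 3 → ℝ)) (i : Fin 2) (u : Fin 2 → ℝ) : Fin 3 → ℝ :=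
  fun a => pd i (fun w => X w a) u

/-- The induced metric `g_{ij}` of a parametrized surface. -/
def firstForm (g : (Fin 3 → ℝ) → Matrix (Fin 3) (Fin 3) ℝ) (X : (Fin 2 → ℝ) → (Fin 3 → ℝ))
    (u : Fin 2 → ℝ) : Matrix (Fin 2) (Fin 2) ℝ :=
  Matrix.of fun i j => metricInner (g (X u)) (tangentVec X i u) (tangentVec X j u)

/-- The covariant derivative of `∂X/∂uʲ` in the direction `∂X/∂uⁱ`, for the Levi-Civita
connection of the ambient metric `g`. -/
def covTangent (g : (Fin 3 → ℝ) → Matrix (Fin 3) (Fin 3) ℝ) (X : (Fin 2 → ℝ) → (Fin 3 → ℝ))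
    (i j : Fin 2) (u : Fin 2 → ℝ) : Fin 3 → ℝ :=
  fun c => pd i (fun w => tangentVec X j w c) u +
    ∑ a, ∑ b, christoffel g (X u) c a b * tangentVec X i u a * tangentVec X j u b

/-- The second fundamental form `h_{ij} = - ⟨D_i ∂_j X, ν⟩` (equivalently `⟨D_i ν, ∂_j X⟩`) with
respect to a unit normal field `ν`; round spheres have positive mean curvature with respect to the
outward normal. -/
def secondForm (g : (Fin 3 → ℝ) → Matrix (Fin 3) (Fin 3) ℝ) (X : (Fin 2 → ℝ) → (Fin 3 → ℝ))
    (ν : (Fin 2 → ℝ) → (Fin 3 → ℝ)) (u : Fin 2 → ℝ) : Matrix (Fin 2) (Fin 2) ℝ :=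
  Matrix.of fun i j => - metricInner (g (X u)) (covTangent g X i j u) (ν u)

/-- The mean curvature `H = g^{ij} h_{ij}`. -/
def meanCurvature (g : (Fin 3 → ℝ) → Matrix (Fin 3) (Fin 3) ℝ) (X : (Fin 2 → ℝ) → (Fin 3 → ℝ))
    (ν : (Fin 2 → ℝ) → (Fin 3 → ℝ)) (u : Fin 2 → ℝ) : ℝ :=
  ∑ i, ∑ j, (firstForm g X u)⁻¹ i j * secondForm g X ν u i j

/-- The density of the area form `dA` with respect to `du¹ du²`. -/
def areaDensity (g : (Fin 3 → ℝ) → Matrix (Fin 3) (Fin 3) ℝ) (X : (Fin 2 → ℝ) → (Fin 3 → ℝ))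
    (u : Fin 2 → ℝ) : ℝ :=
  Real.sqrt (firstForm g X u).det

/-- The density of the volume form `dV` with respect to the coordinate measure. -/
def volumeDensity (g : (Fin 3 → ℝ) → Matrix (Fin 3) (Fin 3) ℝ) (p : Fin 3 → ℝ) : ℝ :=
  Real.sqrt (g p).det

/-! ### The AdS-Melvin space -/

/-- `F(r) = 1 - r⁻³ - b r⁻⁴`. -/
def warp (b r : ℝ) : ℝ := 1 - (r ^ 3)⁻¹ - b * (r ^ 4)⁻¹

/-- `rs` is the largest positive root of `F`. -/
def IsCoreRadius (b rs : ℝ) : Prop := IsGreatest {r : ℝ | 0 < r ∧ warp b r = 0} rs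

/-- The period `4π / (rs² F'(rs))` of the coordinate `y`. -/
def periodY (b rs : ℝ) : ℝ := 4 * Real.pi / (rs ^ 2 * deriv (warp b) rs)

/-- The AdS-Melvin metric `r⁻² F(r)⁻¹ dr² + r² dx² + r² F(r) dy²`. -/
def metric (b : ℝ) (p : Fin 3 → ℝ) : Matrix (Fin 3) (Fin 3) ℝ :=
  Matrix.diagonal
    ![((p 0) ^ 2)⁻¹ * (warp b (p 0))⁻¹, (p 0) ^ 2, (p 0) ^ 2 * warp b (p 0)]

/-! ### Graphs over the torus -/

/-- `s` is a smooth function on the torus with values in the range `(rs, ∞)` of the coordinate `r`,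
i.e. the height function of an embedded graph over the torus. -/
structure IsHeightFunction (rs Px Py : ℝ) (s : (Fin 2 → ℝ) → ℝ) : Prop where
  smooth : ContDiff ℝ ∞ s
  periodic_x : ∀ p, s (p + ![Px, 0]) = s p
  periodic_y : ∀ p, s (p + ![0, Py]) = s p
  gt_core : ∀ p, rs < s p

/-- The parametrization `(x, y) ↦ (s(x, y), x, y)` of the graph `{r = s(x, y)}`. -/
def graphMap (s : (Fin 2 → ℝ) → ℝ) (p : Fin 2 → ℝ) : Fin 3 → ℝ := ![s p, p 0, p 1]

/-- The graph `{r = s(x, y)}`, as a set of coordinate triples. -/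
def graphSet (s : (Fin 2 → ℝ) → ℝ) : Set (Fin 3 → ℝ) := Set.range (graphMap s)

/-- The differential `dr - s_x dx - s_y dy` of the defining function `r - s(x, y)`. -/
def conormal (s : (Fin 2 → ℝ) → ℝ) (p : Fin 2 → ℝ) : Fin 3 → ℝ :=
  ![1, - pd 0 s p, - pd 1 s p]

/-- The outward unit normal `ν` of the graph `{r = s(x, y)}` at the point over `(x, y)`: the
normalized gradient of `r - s(x, y)`. -/
def unitNormal (b : ℝ) (s : (Fin 2 → ℝ) → ℝ) (p : Fin 2 → ℝ) : Fin 3 → ℝ :=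
  (Real.sqrt (metricInner (metric b (graphMap s p))⁻¹ (conormal s p) (conormal s p)))⁻¹ •
    ((metric b (graphMap s p))⁻¹).mulVec (conormal s p)

/-- The mean curvature `H` of the graph with respect to the outward unit normal. -/
def graphMeanCurvature (b : ℝ) (s : (Fin 2 → ℝ) → ℝ) (p : Fin 2 → ℝ) : ℝ :=
  meanCurvature (metric b) (graphMap s) (unitNormal b s) p

/-- `∫_Σ H r dA` for the graph `Σ = {r = s(x, y)}`. -/
def weightedMeanCurvatureIntegral (b Px Py : ℝ) (s : (Fin 2 → ℝ) → ℝ) : ℝ :=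
  ∫ x in (0 : ℝ)..Px, ∫ y in (0 : ℝ)..Py,
    graphMeanCurvature b s ![x, y] * s ![x, y] * areaDensity (metric b) (graphMap s) ![x, y]

/-- `∫_Ω r dV` for the region `Ω = {rs < r < s(x, y)}` enclosed by the graph (the core circle
`{r = rs}` of the solid torus has measure zero). -/
def weightedVolume (b rs Px Py : ℝ) (s : (Fin 2 → ℝ) → ℝ) : ℝ :=
  ∫ x in (0 : ℝ)..Px, ∫ y in (0 : ℝ)..Py, ∫ r in rs..(s ![x, y]),
    r * volumeDensity (metric b) ![r, x, y]

/-- `Q(Σ) = ∫_Σ H r dA - 6 ∫_Ω r dV` for the graph `Σ = {r = s(x, y)}`. -/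
def Q (b rs Px Py : ℝ) (s : (Fin 2 → ℝ) → ℝ) : ℝ :=
  weightedMeanCurvatureIntegral b Px Py s - 6 * weightedVolume b rs Px Py s

/-- The graph of `s` is a coordinate torus `{r ≡ const}`. -/
def IsCoordinateTorus (s : (Fin 2 → ℝ) → ℝ) : Prop := ∃ c : ℝ, ∀ p, s p = c

/-! ### The normal flow -/

/-- The time interval `[0, T₀)`, where `T₀ = ∞` is allowed. -/
def timeInterval (T₀ : EReal) : Set ℝ := {t : ℝ | 0 ≤ t ∧ (t : EReal) < T₀}

/-- The parameters `u`, `v` represent the same point of the torus. -/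
def TorusEq (Px Py : ℝ) (u v : Fin 2 → ℝ) : Prop :=
  ∃ m n : ℤ, v = u + ![m * Px, n * Py]

/-- The coordinate triples `p`, `q` represent the same point of the ambient space. -/
def SpaceEq (Px Py : ℝ) (p q : Fin 3 → ℝ) : Prop :=
  ∃ m n : ℤ, q = p + ![0, m * Px, n * Py]

/-- `X` is (the lift of) a smooth embedding of the torus into the ambient space, with
image the graph `{r = s(x, y)}`.  Since the torus is compact, an embedding is the same as an
injective immersion. -/
structure IsEmbeddedGraph (Px Py : ℝ) (X : (Fin 2 → ℝ) → (Fin 3 → ℝ)) (s : (Fin 2 → ℝ) → ℝ) :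
    Prop where
  smooth : ContDiff ℝ ∞ X
  descends : ∀ u v, TorusEq Px Py u v → SpaceEq Px Py (X u) (X v)
  injective : ∀ u v, SpaceEq Px Py (X u) (X v) → TorusEq Px Py u v
  immersion : ∀ u, LinearIndependent ℝ ![tangentVec X 0 u, tangentVec X 1 u]
  image_eq : {p | ∃ u, SpaceEq Px Py (X u) p} = graphSet s

/-- `φ : [0, T₀) × T² → M` is a smooth family of embedded graphs over the torus, with images
`Σ_t = {r = s(t, x, y)}`, that solves `∂φ/∂t = r⁻¹ ν`, where `ν` is the outward unit normal of
`Σ_t`.  (At `t = 0` the time derivative is one-sided.) -/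
structure IsNormalFlow (b rs Px Py : ℝ) (T₀ : EReal) (φ : ℝ → (Fin 2 → ℝ) → (Fin 3 → ℝ))
    (s : ℝ → (Fin 2 → ℝ) → ℝ) : Prop where
  smooth : ContDiffOn ℝ ∞ (fun q : ℝ × (Fin 2 → ℝ) => φ q.1 q.2)
    (timeInterval T₀ ×ˢ Set.univ)
  smooth_height : ContDiffOn ℝ ∞ (fun q : ℝ × (Fin 2 → ℝ) => s q.1 q.2)
    (timeInterval T₀ ×ˢ Set.univ)
  height : ∀ t ∈ timeInterval T₀, IsHeightFunction rs Px Py (s t)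
  embedded : ∀ t ∈ timeInterval T₀, IsEmbeddedGraph Px Py (φ t) (s t)
  flow : ∀ t ∈ timeInterval T₀, ∀ u,
    HasDerivWithinAt (fun τ => φ τ u)
      ((φ t u 0)⁻¹ • unitNormal b (s t) ![φ t u 1, φ t u 2]) (timeInterval T₀) t

end AdSMelvin

end

/-!
Write `f = r² F`. As a graph `{r = s(t, x, y)}`, the surface moves by `∂s/∂t = |d(r - s)| / s`.
Under this evolution the density of `H r dA` changes by a divergence plus an expression in the
first jet of `s`: the reparametrization as a graph transports the density along a tangential
field, and the second fundamental form enters otherwise only through its determinant, which the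
Gauss equation expresses by the Gauss curvature, a divergence on the torus. Divergences integrate
to zero. The remaining expression is `6 s² ∂s/∂t`, which is cancelled by the derivative of the
volume term, minus `2 ((F + b / s⁴) (∂s/∂x)² + (∂s/∂y)²) / (s² ∂s/∂t)`, which is nonnegative and
vanishes only where `∂s/∂x = ∂s/∂y = 0`.
-/

noncomputable section

namespace AdSMelvin

/-! ### Partial derivatives -/

section PartialDerivatives

variable {E F : Type*} [NormedAddCommGroup E] [NormedSpace ℝ E] [NormedAddCommGroup F]
  [NormedSpace ℝ F]

lemma fderiv_eq_of_hasLineDerivAt {φ : E → ℝ} {z v : E} {φ' : ℝ} (hφ : DifferentiableAt ℝ φ z)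
    (h : HasLineDerivAt ℝ φ φ' z v) : fderiv ℝ φ z v = φ' :=
  (hφ.hasFDerivAt.hasLineDerivAt v).unique h

lemma hasLineDerivAt_fderiv {φ : E → ℝ} {z : E} (hφ : ContDiffAt ℝ ∞ φ z) (v : E) :
    HasLineDerivAt ℝ φ (fderiv ℝ φ z v) z v :=
  (hφ.differentiableAt (by simp)).hasFDerivAt.hasLineDerivAt v

lemma fderivWithin_apply_const {g : E → F} {S : Set E} {x : E} (hS : UniqueDiffOn ℝ S)
    (hg : ContDiffOn ℝ ∞ g S) (hx : x ∈ S) (v w : E) :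
    fderivWithin ℝ (fun y => fderivWithin ℝ g S y w) S x v
      = fderivWithin ℝ (fderivWithin ℝ g S) S x v w := by
  have hd : DifferentiableWithinAt ℝ (fderivWithin ℝ g S) S x :=
    (hg.fderivWithin hS (m := ∞) (by simp) x hx).differentiableWithinAt (by simp)
  simp [fderivWithin_clm_apply (hS x hx) hd (differentiableWithinAt_const w)]

lemma fderivWithin_apply_comm {g : E → F} {S : Set E} {x : E} (hS : UniqueDiffOn ℝ S)
    (hcl : S ⊆ closure (interior S)) (hg : ContDiffOn ℝ ∞ g S) (hx : x ∈ S) (v w : E) :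
    fderivWithin ℝ (fun y => fderivWithin ℝ g S y w) S x v
      = fderivWithin ℝ (fun y => fderivWithin ℝ g S y v) S x w := by
  have hsymm : IsSymmSndFDerivWithinAt ℝ g S x :=
    (hg x hx).isSymmSndFDerivWithinAt (by
      simp only [minSmoothness_of_isRCLikeNormedField]
      exact WithTop.coe_le_coe.2 le_top) hS (hcl hx) hx
  rw [fderivWithin_apply_const hS hg hx, fderivWithin_apply_const hS hg hx, hsymm.eq]

variable {n : ℕ} {g : (Fin n → ℝ) → ℝ}

lemma fderiv_eq_sum_pd (g : (Fin n → ℝ) → ℝ) (p v : Fin n → ℝ) :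
    fderiv ℝ g p v = ∑ i, v i * pd i g p := by
  conv_lhs => rw [pi_eq_sum_univ' v, map_sum]
  simp only [map_smul, smul_eq_mul, pd]

lemma contDiff_pd (hg : ContDiff ℝ ∞ g) (i : Fin n) : ContDiff ℝ ∞ (pd i g) :=
  (hg.fderiv_right (m := ∞) (by simp)).clm_apply contDiff_const

lemma pd_comm (hg : ContDiff ℝ ∞ g) (i k : Fin n) : pd i (pd k g) = pd k (pd i g) := by
  ext p
  have h := fderivWithin_apply_comm uniqueDiffOn_univ (by simp) hg.contDiffOn (Set.mem_univ p)
    (Pi.single i 1) (Pi.single k 1)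
  simp only [fderivWithin_univ] at h
  exact h

lemma periodic_pd {c : Fin n → ℝ} (hg : Function.Periodic g c) (i : Fin n) :
    Function.Periodic (pd i g) c := by
  intro p
  rw [pd, pd, ← fderiv_comp_add_right, show (fun x => g (x + c)) = g from funext hg]

end PartialDerivatives

/-! ### Smooth families of functions -/

lemma prod_univ_subset_closure_interior {E : Type*} [TopologicalSpace E] {I : Set ℝ}
    (hI : Convex ℝ I) (hI' : (interior I).Nonempty) :
    I ×ˢ (Set.univ : Set E) ⊆ closure (interior (I ×ˢ Set.univ)) := by
  rw [interior_prod_eq, interior_univ, closure_prod_eq, closure_univ,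
    hI.closure_interior_eq_closure_of_nonempty_interior hI']
  exact Set.prod_mono_left subset_closure

/-- `h τ p` is smooth in `(τ, p)`, where `τ` runs through the time interval `I` with one-sided
derivatives at the ends of `I`. -/
def IsSmoothFamily {E F : Type*} [NormedAddCommGroup E] [NormedSpace ℝ E] [NormedAddCommGroup F]
    [NormedSpace ℝ F] (I : Set ℝ) (h : ℝ → E → F) : Prop :=
  ContDiffOn ℝ ∞ (fun z : ℝ × E => h z.1 z.2) (I ×ˢ Set.univ)

namespace IsSmoothFamily

variable {E F G : Type*} [NormedAddCommGroup E] [NormedSpace ℝ E] [NormedAddCommGroup F]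
  [NormedSpace ℝ F] [NormedAddCommGroup G] [NormedSpace ℝ G] {I : Set ℝ} {t : ℝ} {p : E}
  {h : ℝ → E → F}

lemma comp (hh : IsSmoothFamily I h) {φ : F → G}
    (hφ : ∀ τ ∈ I, ∀ p, ContDiffAt ℝ ∞ φ (h τ p)) : IsSmoothFamily I fun τ p => φ (h τ p) :=
  fun z hz => (hφ z.1 hz.1 z.2).comp_contDiffWithinAt z (hh z hz)

lemma contDiff (hh : IsSmoothFamily I h) (ht : t ∈ I) : ContDiff ℝ ∞ (h t) :=
  contDiffOn_univ.1 (ContDiffOn.comp (g := fun z : ℝ × E => h z.1 z.2) hh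
    (contDiff_prodMk_right t).contDiffOn fun p _ => Set.mk_mem_prod ht (Set.mem_univ p))

lemma hasFDerivWithinAt (hh : IsSmoothFamily I h) (ht : t ∈ I) (p : E) :
    HasFDerivWithinAt (fun z : ℝ × E => h z.1 z.2)
      (fderivWithin ℝ (fun z : ℝ × E => h z.1 z.2) (I ×ˢ Set.univ) (t, p))
      (I ×ˢ Set.univ) (t, p) :=
  ((hh (t, p) ⟨ht, trivial⟩).differentiableWithinAt (by simp)).hasFDerivWithinAt

lemma fderiv_apply (hh : IsSmoothFamily I h) (ht : t ∈ I) (p v : E) :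
    fderiv ℝ (h t) p v
      = fderivWithin ℝ (fun z : ℝ × E => h z.1 z.2) (I ×ˢ Set.univ) (t, p) (0, v) := by
  have hslice : HasFDerivWithinAt (fun q : E => (t, q)) (ContinuousLinearMap.inr ℝ ℝ E)
      Set.univ p := (hasFDerivAt_prodMk_right t p).hasFDerivWithinAt
  have hcomp := (hh.hasFDerivWithinAt ht p).comp p hslice fun q _ =>
    Set.mk_mem_prod ht (Set.mem_univ q)
  have heq : fderiv ℝ (h t) p = _ := (hcomp.hasFDerivAt Filter.univ_mem).fderiv
  rw [heq]
  rfl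

lemma hasDerivWithinAt_comp {γ : ℝ → E} {v : E} (hh : IsSmoothFamily I h) (ht : t ∈ I)
    (hγ : HasDerivWithinAt γ v I t) :
    HasDerivWithinAt (fun τ => h τ (γ τ))
      (fderivWithin ℝ (fun z : ℝ × E => h z.1 z.2) (I ×ˢ Set.univ) (t, γ t) (1, 0)
        + fderiv ℝ (h t) (γ t) v) I t := by
  rw [hh.fderiv_apply ht, ← map_add, Prod.mk_add_mk, add_zero, zero_add]
  exact HasFDerivWithinAt.comp_hasDerivWithinAt (f := fun τ => (τ, γ τ)) t
    (hh.hasFDerivWithinAt ht (γ t)) ((hasDerivWithinAt_id t I).prodMk hγ) fun _ hτ =>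
      Set.mk_mem_prod hτ (Set.mem_univ _)

lemma hasDerivWithinAt (hh : IsSmoothFamily I h) (ht : t ∈ I) (p : E) :
    HasDerivWithinAt (fun τ => h τ p)
      (fderivWithin ℝ (fun z : ℝ × E => h z.1 z.2) (I ×ˢ Set.univ) (t, p) (1, 0)) I t := by
  simpa using hh.hasDerivWithinAt_comp ht (hasDerivWithinAt_const t I p)

lemma uniqueDiffOn_prod (hI : Convex ℝ I) (hI' : (interior I).Nonempty) :
    UniqueDiffOn ℝ (I ×ˢ (Set.univ : Set E)) :=
  (uniqueDiffOn_convex hI hI').prod uniqueDiffOn_univ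

lemma fderivWithin_apply (hI : Convex ℝ I) (hI' : (interior I).Nonempty)
    (hh : IsSmoothFamily I h) (v : ℝ × E) :
    IsSmoothFamily I fun τ p =>
      fderivWithin ℝ (fun z : ℝ × E => h z.1 z.2) (I ×ˢ Set.univ) (τ, p) v :=
  (ContDiffOn.fderivWithin hh (uniqueDiffOn_prod hI hI') (by simp)).clm_apply contDiffOn_const

lemma hasDerivWithinAt_fderiv (hI : Convex ℝ I) (hI' : (interior I).Nonempty)
    (hh : IsSmoothFamily I h) (ht : t ∈ I) {u : E → F}
    (hu : ∀ q, HasDerivWithinAt (fun τ => h τ q) (u q) I t) (p v : E) :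
    HasDerivWithinAt (fun τ => fderiv ℝ (h τ) p v) (fderiv ℝ u p v) I t := by
  have hut : u = fun q => fderivWithin ℝ (fun z : ℝ × E => h z.1 z.2) (I ×ˢ Set.univ) (t, q)
      (1, 0) :=
    funext fun q => (uniqueDiffOn_convex hI hI' t ht).eq_deriv _ (hu q) (hh.hasDerivWithinAt ht q)
  have hspace := (hh.fderivWithin_apply hI hI' (0, v)).hasDerivWithinAt ht p
  rw [fderivWithin_apply_comm (uniqueDiffOn_prod hI hI')
    (prod_univ_subset_closure_interior hI hI') hh ⟨ht, trivial⟩,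
    ← (hh.fderivWithin_apply hI hI' (1, 0)).fderiv_apply ht p v, ← hut] at hspace
  exact hspace.congr_of_mem (fun τ hτ => hh.fderiv_apply hτ p v) ht

protected lemma pd {n : ℕ} {h : ℝ → (Fin n → ℝ) → ℝ} (hI : Convex ℝ I)
    (hI' : (interior I).Nonempty) (hh : IsSmoothFamily I h) (i : Fin n) :
    IsSmoothFamily I fun τ => pd i (h τ) :=
  (hh.fderivWithin_apply hI hI' (0, Pi.single i 1)).congr fun z hz =>
    hh.fderiv_apply hz.1 z.2 (Pi.single i 1)

end IsSmoothFamily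

/-! ### Jets -/

/-- The two-jet of a function of two variables at a point, listed as value, first partial
derivatives and second partial derivatives. -/
abbrev Jet : Type := Fin 6 → ℝ

namespace Jet

/-- The value of the jet. -/
abbrev s (j : Jet) : ℝ := j 0

/-- The derivative `s_x`. -/
abbrev p (j : Jet) : ℝ := j 1

/-- The derivative `s_y`. -/
abbrev q (j : Jet) : ℝ := j 2

/-- The derivative `s_xx`. -/
abbrev a (j : Jet) : ℝ := j 3

/-- The derivative `s_xy`. -/
abbrev b (j : Jet) : ℝ := j 4

/-- The derivative `s_yy`. -/
abbrev c (j : Jet) : ℝ := j 5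

/-- The total derivative in `x` of the jet of a function with third derivatives
`d = (s_xxx, s_xxy, s_xyy, s_yyy)`. -/
def totalX (j : Jet) (d : Fin 4 → ℝ) : Jet := ![j.p, j.a, j.b, d 0, d 1, d 2]

/-- The total derivative in `y` of the jet of a function with third derivatives
`d = (s_xxx, s_xxy, s_xyy, s_yyy)`. -/
def totalY (j : Jet) (d : Fin 4 → ℝ) : Jet := ![j.q, j.b, j.c, d 1, d 2, d 3]

/-- The jet of `√m`, divided by `√m`, for a function with jet `m`. -/
def relSqrt (m : Jet) : Jet :=
  ![1, m.p / (2 * m.s), m.q / (2 * m.s), m.a / (2 * m.s) - m.p ^ 2 / (4 * m.s ^ 2),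
    m.b / (2 * m.s) - m.p * m.q / (4 * m.s ^ 2), m.c / (2 * m.s) - m.q ^ 2 / (4 * m.s ^ 2)]

/-! ### Geometry of graphs in terms of jets -/

variable (f : ℝ → ℝ) (j : Jet)

/-- `j` is the jet of the height function `s` of a graph `{r = s(x, y)}` in a region where
`f(r)⁻¹ dr² + r² dx² + f(r) dy²` is a smooth Riemannian metric.  For the AdS-Melvin space,
`f = r² F`. -/
structure IsAdmissible : Prop where
  contDiffOn : ContDiffOn ℝ ∞ f (Set.Ioi 0)
  s_pos : 0 < j.s
  profile_pos : 0 < f j.s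

/-- `|d(r - s)|² / s²` on the graph `{r = s(x, y)}`. -/
def speedSq : ℝ := f j.s / j.s ^ 2 + j.p ^ 2 / j.s ^ 4 + j.q ^ 2 / (j.s ^ 2 * f j.s)

/-- The speed `∂s/∂t` of the height function under the flow `∂φ/∂t = r⁻¹ ν`. -/
def speed : ℝ := √(speedSq f j)

/-- The `xx`-component of the Hessian of `s - r` along the graph; the second fundamental form is
the negative of this Hessian, divided by `|d(r - s)|`. -/
def hessXX : ℝ := j.a - deriv f j.s * j.p ^ 2 / (2 * f j.s) - f j.s * j.s - 2 * j.p ^ 2 / j.s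

/-- The `xy`-component of the Hessian of `s - r` along the graph. -/
def hessXY : ℝ := j.b - j.p * j.q * (deriv f j.s / f j.s + 1 / j.s)

/-- The `yy`-component of the Hessian of `s - r` along the graph. -/
def hessYY : ℝ := j.c - 3 * deriv f j.s * j.q ^ 2 / (2 * f j.s) - f j.s * deriv f j.s / 2

/-- The determinant of the Hessian of `s - r` along the graph. -/
def hessDet : ℝ := hessXX f j * hessYY f j - hessXY f j ^ 2

/-- The trace of the Hessian of `s - r` along the graph, times the determinant of the first
fundamental form. -/
def hessTrace : ℝ :=
  (f j.s + j.q ^ 2 / f j.s) * hessXX f j - 2 * (j.p * j.q / f j.s) * hessXY f j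
    + (j.s ^ 2 + j.p ^ 2 / f j.s) * hessYY f j

/-- The density of `H r dA` on the graph with respect to `dx dy`. -/
def curvDensity : ℝ := -hessTrace f j / (j.s ^ 2 * speedSq f j)

/-- Minus the `x`-component, times `speed`, of a vector field on the torus whose divergence is the
density `K dA` of the Gauss curvature, up to terms in the first jet. -/
def gaussFluxX : ℝ :=
  j.q * (hessXY f j + j.p * j.q * deriv f j.s / (2 * f j.s)) / (j.s ^ 2 * f j.s + j.p ^ 2)
    + j.p * deriv f j.s / (2 * j.s ^ 2)

/-- The `y`-component, times `speed`, of the vector field of `gaussFluxX`. -/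
def gaussFluxY : ℝ := j.q * hessXX f j / (j.s ^ 2 * f j.s + j.p ^ 2)

/-- The `x`-component of the flux in the evolution of `curvDensity`: the first term comes from
the tangential part of the reparametrization as a graph, the second from the Gauss curvature. -/
def fluxX : ℝ := (curvDensity f j * j.p / j.s ^ 4 - 2 * gaussFluxX f j) / speed f j

/-- The `y`-component of the flux in the evolution of `curvDensity`. -/
def fluxY : ℝ := (curvDensity f j * j.q / (j.s ^ 2 * f j.s) + 2 * gaussFluxY f j) / speed f j

/-- The part of the evolution of `curvDensity` which is not a divergence. -/
def reaction : ℝ :=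
  speed f j * (2 * j.s * deriv f j.s + j.s ^ 2 * deriv (deriv f) j.s / 2 + f j.s
    + ((deriv (deriv f) j.s / 2 - 3 * f j.s / j.s ^ 2) * j.p ^ 2 - 2 * j.q ^ 2)
      / (j.s ^ 2 * speedSq f j))

variable {f j}

lemma IsAdmissible.speedSq_pos (h : IsAdmissible f j) : 0 < speedSq f j := by
  have hs := h.s_pos
  have hf := h.profile_pos
  unfold speedSq
  positivity

lemma IsAdmissible.speed_pos (h : IsAdmissible f j) : 0 < speed f j :=
  Real.sqrt_pos.2 h.speedSq_pos

lemma IsAdmissible.sq_speed (h : IsAdmissible f j) : speed f j ^ 2 = speedSq f j :=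
  Real.sq_sqrt h.speedSq_pos.le

lemma IsAdmissible.speedSq_eq_div (h : IsAdmissible f j) :
    speedSq f j
      = (f j.s * (j.s ^ 2 * f j.s + j.p ^ 2) + j.s ^ 2 * j.q ^ 2) / (j.s ^ 4 * f j.s) := by
  have hs := h.s_pos.ne'
  have hf := h.profile_pos.ne'
  unfold speedSq
  field_simp

section Smoothness

lemma IsAdmissible.contDiffAt_profile (h : IsAdmissible f j) : ContDiffAt ℝ ∞ f j.s :=
  h.contDiffOn.contDiffAt (Ioi_mem_nhds h.s_pos)

lemma IsAdmissible.contDiffAt_deriv (h : IsAdmissible f j) : ContDiffAt ℝ ∞ (deriv f) j.s :=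
  (h.contDiffOn.deriv_of_isOpen isOpen_Ioi le_rfl).contDiffAt (Ioi_mem_nhds h.s_pos)

lemma IsAdmissible.contDiffAt_speedSq (h : IsAdmissible f j) : ContDiffAt ℝ ∞ (speedSq f) j := by
  have hf := h.contDiffAt_profile
  have hs := h.s_pos.ne'
  have hf₀ := h.profile_pos.ne'
  unfold speedSq
  fun_prop (disch := first | assumption | positivity)

lemma IsAdmissible.contDiffAt_speed (h : IsAdmissible f j) : ContDiffAt ℝ ∞ (speed f) j :=
  h.contDiffAt_speedSq.sqrt h.speedSq_pos.ne'

lemma IsAdmissible.contDiffAt_hessXX (h : IsAdmissible f j) : ContDiffAt ℝ ∞ (hessXX f) j := by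
  have hf := h.contDiffAt_profile
  have hf' := h.contDiffAt_deriv
  have hs := h.s_pos.ne'
  have hf₀ := h.profile_pos.ne'
  unfold hessXX
  fun_prop (disch := first | assumption | positivity)

lemma IsAdmissible.contDiffAt_hessXY (h : IsAdmissible f j) : ContDiffAt ℝ ∞ (hessXY f) j := by
  have hf := h.contDiffAt_profile
  have hf' := h.contDiffAt_deriv
  have hs := h.s_pos.ne'
  have hf₀ := h.profile_pos.ne'
  unfold hessXY
  fun_prop (disch := first | assumption | positivity)

lemma IsAdmissible.contDiffAt_hessYY (h : IsAdmissible f j) : ContDiffAt ℝ ∞ (hessYY f) j := by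
  have hf := h.contDiffAt_profile
  have hf' := h.contDiffAt_deriv
  have hf₀ := h.profile_pos.ne'
  unfold hessYY
  fun_prop (disch := first | assumption | positivity)

lemma IsAdmissible.contDiffAt_hessTrace (h : IsAdmissible f j) :
    ContDiffAt ℝ ∞ (hessTrace f) j := by
  have hf := h.contDiffAt_profile
  have hXX := h.contDiffAt_hessXX
  have hXY := h.contDiffAt_hessXY
  have hYY := h.contDiffAt_hessYY
  have hf₀ := h.profile_pos.ne'
  unfold hessTrace
  fun_prop (disch := first | assumption | positivity)

lemma IsAdmissible.contDiffAt_curvDensity (h : IsAdmissible f j) :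
    ContDiffAt ℝ ∞ (curvDensity f) j := by
  have hT := h.contDiffAt_hessTrace
  have hM := h.contDiffAt_speedSq
  have hs := h.s_pos.ne'
  have hM₀ := h.speedSq_pos.ne'
  unfold curvDensity
  fun_prop (disch := first | assumption | positivity)

lemma IsAdmissible.contDiffAt_gaussFluxX (h : IsAdmissible f j) :
    ContDiffAt ℝ ∞ (gaussFluxX f) j := by
  have hf := h.contDiffAt_profile
  have hf' := h.contDiffAt_deriv
  have hXY := h.contDiffAt_hessXY
  have hs := h.s_pos
  have hf₀ := h.profile_pos
  unfold gaussFluxX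
  fun_prop (disch := positivity)

lemma IsAdmissible.contDiffAt_gaussFluxY (h : IsAdmissible f j) :
    ContDiffAt ℝ ∞ (gaussFluxY f) j := by
  have hf := h.contDiffAt_profile
  have hXX := h.contDiffAt_hessXX
  have hs := h.s_pos
  have hf₀ := h.profile_pos
  unfold gaussFluxY
  fun_prop (disch := positivity)

lemma IsAdmissible.contDiffAt_fluxX (h : IsAdmissible f j) : ContDiffAt ℝ ∞ (fluxX f) j := by
  have hJ := h.contDiffAt_curvDensity
  have hG := h.contDiffAt_gaussFluxX
  have hu := h.contDiffAt_speed
  have hs := h.s_pos.ne'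
  have hu₀ := h.speed_pos.ne'
  unfold fluxX
  fun_prop (disch := first | assumption | positivity)

lemma IsAdmissible.contDiffAt_fluxY (h : IsAdmissible f j) : ContDiffAt ℝ ∞ (fluxY f) j := by
  have hf := h.contDiffAt_profile
  have hJ := h.contDiffAt_curvDensity
  have hG := h.contDiffAt_gaussFluxY
  have hu := h.contDiffAt_speed
  have hs := h.s_pos.ne'
  have hf₀ := h.profile_pos.ne'
  have hu₀ := h.speed_pos.ne'
  unfold fluxY
  fun_prop (disch := first | assumption | positivity)

end Smoothness

section Linearization

lemma hasLineDerivAt_apply (j v : Jet) (k : Fin 6) :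
    HasLineDerivAt ℝ (fun i : Jet => i k) (v k) j v := by
  simpa using (hasFDerivAt_apply (𝕜 := ℝ) k j).hasLineDerivAt v

lemma IsAdmissible.hasLineDerivAt_profile (h : IsAdmissible f j) (v : Jet) :
    HasLineDerivAt ℝ (fun i : Jet => f i.s) (deriv f j.s * v.s) j v := by
  have hf := (h.contDiffAt_profile.differentiableAt (by simp)).hasDerivAt
  exact (hf.comp_hasFDerivAt j (hasFDerivAt_apply (𝕜 := ℝ) 0 j)).hasLineDerivAt v

lemma IsAdmissible.hasLineDerivAt_deriv (h : IsAdmissible f j) (v : Jet) :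
    HasLineDerivAt ℝ (fun i : Jet => deriv f i.s) (deriv (deriv f) j.s * v.s) j v := by
  have hf := (h.contDiffAt_deriv.differentiableAt (by simp)).hasDerivAt
  exact (hf.comp_hasFDerivAt j (hasFDerivAt_apply (𝕜 := ℝ) 0 j)).hasLineDerivAt v

lemma IsAdmissible.eventually (h : IsAdmissible f j) : ∀ᶠ i in nhds j, IsAdmissible f i := by
  have hs : Continuous fun i : Jet => i.s := continuous_apply 0
  have hf : ContinuousAt (fun i : Jet => f i.s) j :=
    ContinuousAt.comp h.contDiffAt_profile.continuousAt hs.continuousAt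
  filter_upwards [hs.continuousAt.eventually_const_lt h.s_pos,
    hf.eventually_const_lt h.profile_pos] with i hi hfi
  exact ⟨h.contDiffOn, hi, hfi⟩

lemma IsAdmissible.fderiv_speedSq (h : IsAdmissible f j) (v : Jet) :
    fderiv ℝ (speedSq f) j v =
      (deriv f j.s / j.s ^ 2 - 2 * f j.s / j.s ^ 3 - 4 * j.p ^ 2 / j.s ^ 5
        - 2 * j.q ^ 2 / (j.s ^ 3 * f j.s) - deriv f j.s * j.q ^ 2 / (j.s ^ 2 * f j.s ^ 2)) * v.s
      + 2 * j.p / j.s ^ 4 * v.p + 2 * j.q / (j.s ^ 2 * f j.s) * v.q := by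
  refine fderiv_eq_of_hasLineDerivAt (h.contDiffAt_speedSq.differentiableAt (by simp)) ?_
  have hs₀ := h.s_pos.ne'
  have hf₀ := h.profile_pos.ne'
  have hs := hasLineDerivAt_apply j v 0
  have hp := hasLineDerivAt_apply j v 1
  have hq := hasLineDerivAt_apply j v 2
  have hf := h.hasLineDerivAt_profile v
  unfold HasLineDerivAt at *
  refine (((hf.fun_div (hs.fun_pow 2) ?_).fun_add
    ((hp.fun_pow 2).fun_div (hs.fun_pow 4) ?_)).fun_add
    ((hq.fun_pow 2).fun_div ((hs.fun_pow 2).fun_mul hf) ?_)).congr_deriv ?_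
  all_goals simp only [zero_smul, add_zero]
  · positivity
  · positivity
  · positivity
  · field_simp
    ring

lemma IsAdmissible.fderiv_fderiv_speedSq (h : IsAdmissible f j) (v w : Jet) :
    fderiv ℝ (fderiv ℝ (speedSq f)) j v w =
      (deriv (deriv f) j.s / j.s ^ 2 - 4 * deriv f j.s / j.s ^ 3 + 6 * f j.s / j.s ^ 4
        + 20 * j.p ^ 2 / j.s ^ 6
        + (6 / (j.s ^ 4 * f j.s) + 4 * deriv f j.s / (j.s ^ 3 * f j.s ^ 2)
          - deriv (deriv f) j.s / (j.s ^ 2 * f j.s ^ 2)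
          + 2 * deriv f j.s ^ 2 / (j.s ^ 2 * f j.s ^ 3)) * j.q ^ 2) * v.s * w.s
      - 8 * j.p / j.s ^ 5 * (v.s * w.p + v.p * w.s)
      - 2 * (2 / (j.s ^ 3 * f j.s) + deriv f j.s / (j.s ^ 2 * f j.s ^ 2)) * j.q
        * (v.s * w.q + v.q * w.s)
      + 2 / j.s ^ 4 * v.p * w.p + 2 / (j.s ^ 2 * f j.s) * v.q * w.q := by
  have hd : DifferentiableAt ℝ (fderiv ℝ (speedSq f)) j :=
    (h.contDiffAt_speedSq.fderiv_right (m := 1) (by decide)).differentiableAt (by simp)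
  have hw : fderiv ℝ (fderiv ℝ (speedSq f)) j v w
      = fderiv ℝ (fun i => fderiv ℝ (speedSq f) i w) j v := by
    simp [fderiv_clm_apply hd (differentiableAt_const w)]
  rw [hw]
  refine fderiv_eq_of_hasLineDerivAt (by fun_prop) (HasLineDerivAt.congr_of_eventuallyEq ?_
    (h.eventually.mono fun i hi => hi.fderiv_speedSq w))
  have hs₀ := h.s_pos.ne'
  have hf₀ := h.profile_pos.ne'
  have hs := hasLineDerivAt_apply j v 0
  have hp := hasLineDerivAt_apply j v 1
  have hq := hasLineDerivAt_apply j v 2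
  have hf := h.hasLineDerivAt_profile v
  have hf' := h.hasLineDerivAt_deriv v
  unfold HasLineDerivAt at *
  refine ((((((((hf'.fun_div (hs.fun_pow 2) ?_).fun_sub
    ((hf.const_mul 2).fun_div (hs.fun_pow 3) ?_)).fun_sub
    (((hp.fun_pow 2).const_mul 4).fun_div (hs.fun_pow 5) ?_)).fun_sub
    (((hq.fun_pow 2).const_mul 2).fun_div ((hs.fun_pow 3).fun_mul hf) ?_)).fun_sub
    ((hf'.fun_mul (hq.fun_pow 2)).fun_div ((hs.fun_pow 2).fun_mul (hf.fun_pow 2)) ?_)).mul_const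
    w.s).fun_add
    (((hp.const_mul 2).fun_div (hs.fun_pow 4) ?_).mul_const w.p)).fun_add
    (((hq.const_mul 2).fun_div ((hs.fun_pow 2).fun_mul hf) ?_).mul_const w.q)).congr_deriv ?_
  all_goals simp only [zero_smul, add_zero]
  any_goals positivity
  field_simp
  ring

lemma IsAdmissible.fderiv_hessXX (h : IsAdmissible f j) (v : Jet) :
    fderiv ℝ (hessXX f) j v =
      v.a - deriv f j.s * j.p * v.p / f j.s
        - (deriv (deriv f) j.s / f j.s - deriv f j.s ^ 2 / f j.s ^ 2) * j.p ^ 2 * v.s / 2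
        - (f j.s + deriv f j.s * j.s) * v.s - 4 * j.p * v.p / j.s
        + 2 * j.p ^ 2 * v.s / j.s ^ 2 := by
  refine fderiv_eq_of_hasLineDerivAt (h.contDiffAt_hessXX.differentiableAt (by simp)) ?_
  have hs₀ := h.s_pos.ne'
  have hf₀ := h.profile_pos.ne'
  have hs := hasLineDerivAt_apply j v 0
  have hp := hasLineDerivAt_apply j v 1
  have ha := hasLineDerivAt_apply j v 3
  have hf := h.hasLineDerivAt_profile v
  have hf' := h.hasLineDerivAt_deriv v
  unfold HasLineDerivAt at *
  refine (((ha.fun_sub ((hf'.fun_mul (hp.fun_pow 2)).fun_div (hf.const_mul 2) ?_)).fun_sub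
    (hf.fun_mul hs)).fun_sub (((hp.fun_pow 2).const_mul 2).fun_div hs ?_)).congr_deriv ?_
  all_goals simp only [zero_smul, add_zero]
  · positivity
  · positivity
  · field_simp
    ring

lemma IsAdmissible.fderiv_hessXY (h : IsAdmissible f j) (v : Jet) :
    fderiv ℝ (hessXY f) j v =
      v.b - (v.p * j.q + j.p * v.q) * (deriv f j.s / f j.s + 1 / j.s)
        - j.p * j.q * (deriv (deriv f) j.s / f j.s - deriv f j.s ^ 2 / f j.s ^ 2 - 1 / j.s ^ 2)
          * v.s := by
  refine fderiv_eq_of_hasLineDerivAt (h.contDiffAt_hessXY.differentiableAt (by simp)) ?_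
  have hs₀ := h.s_pos.ne'
  have hf₀ := h.profile_pos.ne'
  have hs := hasLineDerivAt_apply j v 0
  have hp := hasLineDerivAt_apply j v 1
  have hq := hasLineDerivAt_apply j v 2
  have hb := hasLineDerivAt_apply j v 4
  have hf := h.hasLineDerivAt_profile v
  have hf' := h.hasLineDerivAt_deriv v
  unfold HasLineDerivAt at *
  have hinv := (hasDerivAt_const (0 : ℝ) (1 : ℝ)).fun_div hs (by simpa using hs₀)
  refine (hb.fun_sub ((hp.fun_mul hq).fun_mul ((hf'.fun_div hf ?_).fun_add hinv))).congr_deriv ?_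
  all_goals simp only [zero_smul, add_zero]
  · positivity
  · field_simp
    ring

lemma IsAdmissible.fderiv_hessYY (h : IsAdmissible f j) (v : Jet) :
    fderiv ℝ (hessYY f) j v =
      v.c - 3 * deriv f j.s * j.q * v.q / f j.s
        - 3 * (deriv (deriv f) j.s / f j.s - deriv f j.s ^ 2 / f j.s ^ 2) * j.q ^ 2 * v.s / 2
        - (deriv f j.s ^ 2 + f j.s * deriv (deriv f) j.s) * v.s / 2 := by
  refine fderiv_eq_of_hasLineDerivAt (h.contDiffAt_hessYY.differentiableAt (by simp)) ?_
  have hf₀ := h.profile_pos.ne'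
  have hq := hasLineDerivAt_apply j v 2
  have hc := hasLineDerivAt_apply j v 5
  have hf := h.hasLineDerivAt_profile v
  have hf' := h.hasLineDerivAt_deriv v
  unfold HasLineDerivAt at *
  refine ((hc.fun_sub (((hf'.const_mul 3).fun_mul (hq.fun_pow 2)).fun_div
    (hf.const_mul 2) ?_)).fun_sub ((hf.fun_mul hf').div_const 2)).congr_deriv ?_
  all_goals simp only [zero_smul, add_zero]
  · positivity
  · field_simp
    ring

lemma IsAdmissible.fderiv_hessTrace (h : IsAdmissible f j) (v : Jet) :
    fderiv ℝ (hessTrace f) j v =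
      (deriv f j.s * v.s + 2 * j.q * v.q / f j.s - j.q ^ 2 * deriv f j.s * v.s / f j.s ^ 2)
          * hessXX f j
        + (f j.s + j.q ^ 2 / f j.s) * fderiv ℝ (hessXX f) j v
        - 2 * ((v.p * j.q + j.p * v.q) / f j.s - j.p * j.q * deriv f j.s * v.s / f j.s ^ 2)
          * hessXY f j
        - 2 * (j.p * j.q / f j.s) * fderiv ℝ (hessXY f) j v
        + (2 * j.s * v.s + 2 * j.p * v.p / f j.s - j.p ^ 2 * deriv f j.s * v.s / f j.s ^ 2)
          * hessYY f j
        + (j.s ^ 2 + j.p ^ 2 / f j.s) * fderiv ℝ (hessYY f) j v := by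
  refine fderiv_eq_of_hasLineDerivAt (h.contDiffAt_hessTrace.differentiableAt (by simp)) ?_
  have hf₀ := h.profile_pos.ne'
  have hs := hasLineDerivAt_apply j v 0
  have hp := hasLineDerivAt_apply j v 1
  have hq := hasLineDerivAt_apply j v 2
  have hf := h.hasLineDerivAt_profile v
  have hXX := hasLineDerivAt_fderiv h.contDiffAt_hessXX v
  have hXY := hasLineDerivAt_fderiv h.contDiffAt_hessXY v
  have hYY := hasLineDerivAt_fderiv h.contDiffAt_hessYY v
  unfold HasLineDerivAt at *
  refine ((((hf.fun_add ((hq.fun_pow 2).fun_div hf ?_)).fun_mul hXX).fun_sub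
    ((((hp.fun_mul hq).fun_div hf ?_).const_mul 2).fun_mul hXY)).fun_add
    (((hs.fun_pow 2).fun_add ((hp.fun_pow 2).fun_div hf ?_)).fun_mul hYY)).congr_deriv ?_
  all_goals simp only [zero_smul, add_zero]
  · positivity
  · positivity
  · positivity
  · field_simp
    ring

lemma IsAdmissible.fderiv_curvDensity (h : IsAdmissible f j) (v : Jet) :
    fderiv ℝ (curvDensity f) j v =
      -fderiv ℝ (hessTrace f) j v / (j.s ^ 2 * speedSq f j)
        - curvDensity f j * (2 * v.s / j.s + fderiv ℝ (speedSq f) j v / speedSq f j) := by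
  refine fderiv_eq_of_hasLineDerivAt (h.contDiffAt_curvDensity.differentiableAt (by simp)) ?_
  have hs₀ := h.s_pos.ne'
  have hM₀ := h.speedSq_pos.ne'
  have hs := hasLineDerivAt_apply j v 0
  have hT := hasLineDerivAt_fderiv h.contDiffAt_hessTrace v
  have hM := hasLineDerivAt_fderiv h.contDiffAt_speedSq v
  unfold HasLineDerivAt at *
  refine (hT.fun_neg.fun_div ((hs.fun_pow 2).fun_mul hM) ?_).congr_deriv ?_
  all_goals simp only [zero_smul, add_zero]
  · positivity
  · unfold curvDensity
    field_simp
    ring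

lemma IsAdmissible.fderiv_speed (h : IsAdmissible f j) (v : Jet) :
    fderiv ℝ (speed f) j v = fderiv ℝ (speedSq f) j v / (2 * speed f j) := by
  have hM := (h.contDiffAt_speedSq.differentiableAt (by simp)).hasFDerivAt
  rw [show speed f = fun i => √(speedSq f i) from rfl, (hM.sqrt h.speedSq_pos.ne').fderiv,
    smul_apply, smul_eq_mul]
  ring

lemma IsAdmissible.fderiv_gaussFluxX (h : IsAdmissible f j) (v : Jet) :
    fderiv ℝ (gaussFluxX f) j v =
      (v.q * (hessXY f j + j.p * j.q * deriv f j.s / (2 * f j.s))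
          + j.q * (fderiv ℝ (hessXY f) j v + (v.p * j.q + j.p * v.q) * deriv f j.s / (2 * f j.s)
            + j.p * j.q * (deriv (deriv f) j.s / f j.s - deriv f j.s ^ 2 / f j.s ^ 2) * v.s / 2))
          / (j.s ^ 2 * f j.s + j.p ^ 2)
        - j.q * (hessXY f j + j.p * j.q * deriv f j.s / (2 * f j.s))
          * (2 * j.s * v.s * f j.s + j.s ^ 2 * deriv f j.s * v.s + 2 * j.p * v.p)
          / (j.s ^ 2 * f j.s + j.p ^ 2) ^ 2
        + (v.p * deriv f j.s + j.p * deriv (deriv f) j.s * v.s) / (2 * j.s ^ 2)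
        - j.p * deriv f j.s * v.s / j.s ^ 3 := by
  refine fderiv_eq_of_hasLineDerivAt (h.contDiffAt_gaussFluxX.differentiableAt (by simp)) ?_
  have hs₀ := h.s_pos
  have hf₀ := h.profile_pos
  have hN₀ : j.s ^ 2 * f j.s + j.p ^ 2 ≠ 0 := by positivity
  have hs := hasLineDerivAt_apply j v 0
  have hp := hasLineDerivAt_apply j v 1
  have hq := hasLineDerivAt_apply j v 2
  have hf := h.hasLineDerivAt_profile v
  have hf' := h.hasLineDerivAt_deriv v
  have hXY := hasLineDerivAt_fderiv h.contDiffAt_hessXY v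
  unfold HasLineDerivAt at *
  refine (((hq.fun_mul (hXY.fun_add (((hp.fun_mul hq).fun_mul hf').fun_div (hf.const_mul 2)
    ?_))).fun_div (((hs.fun_pow 2).fun_mul hf).fun_add (hp.fun_pow 2)) ?_).fun_add
    ((hp.fun_mul hf').fun_div ((hs.fun_pow 2).const_mul 2) ?_)).congr_deriv ?_
  all_goals simp only [zero_smul, add_zero]
  · positivity
  · exact hN₀
  · positivity
  · generalize hN : j.s ^ 2 * f j.s + j.p ^ 2 = N at *
    field_simp
    subst hN
    ring

lemma IsAdmissible.fderiv_gaussFluxY (h : IsAdmissible f j) (v : Jet) :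
    fderiv ℝ (gaussFluxY f) j v =
      (v.q * hessXX f j + j.q * fderiv ℝ (hessXX f) j v) / (j.s ^ 2 * f j.s + j.p ^ 2)
        - j.q * hessXX f j
          * (2 * j.s * v.s * f j.s + j.s ^ 2 * deriv f j.s * v.s + 2 * j.p * v.p)
          / (j.s ^ 2 * f j.s + j.p ^ 2) ^ 2 := by
  refine fderiv_eq_of_hasLineDerivAt (h.contDiffAt_gaussFluxY.differentiableAt (by simp)) ?_
  have hs₀ := h.s_pos
  have hf₀ := h.profile_pos
  have hN₀ : j.s ^ 2 * f j.s + j.p ^ 2 ≠ 0 := by positivity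
  have hs := hasLineDerivAt_apply j v 0
  have hp := hasLineDerivAt_apply j v 1
  have hq := hasLineDerivAt_apply j v 2
  have hf := h.hasLineDerivAt_profile v
  have hXX := hasLineDerivAt_fderiv h.contDiffAt_hessXX v
  unfold HasLineDerivAt at *
  refine ((hq.fun_mul hXX).fun_div
    (((hs.fun_pow 2).fun_mul hf).fun_add (hp.fun_pow 2)) ?_).congr_deriv ?_
  all_goals simp only [zero_smul, add_zero]
  · exact hN₀
  · generalize hN : j.s ^ 2 * f j.s + j.p ^ 2 = N at *
    field_simp
    subst hN
    ring

lemma IsAdmissible.fderiv_fluxX (h : IsAdmissible f j) (v : Jet) :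
    fderiv ℝ (fluxX f) j v =
      ((fderiv ℝ (curvDensity f) j v * j.p + curvDensity f j * v.p) / j.s ^ 4
          - 4 * curvDensity f j * j.p * v.s / j.s ^ 5 - 2 * fderiv ℝ (gaussFluxX f) j v)
          / speed f j
        - fluxX f j * fderiv ℝ (speedSq f) j v / (2 * speedSq f j) := by
  refine fderiv_eq_of_hasLineDerivAt (h.contDiffAt_fluxX.differentiableAt (by simp)) ?_
  have hs₀ := h.s_pos.ne'
  have hu₀ := h.speed_pos.ne'
  have hs := hasLineDerivAt_apply j v 0
  have hp := hasLineDerivAt_apply j v 1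
  have hJ := hasLineDerivAt_fderiv h.contDiffAt_curvDensity v
  have hG := hasLineDerivAt_fderiv h.contDiffAt_gaussFluxX v
  have hu := hasLineDerivAt_fderiv h.contDiffAt_speed v
  unfold HasLineDerivAt at *
  refine ((((hJ.fun_mul hp).fun_div (hs.fun_pow 4) ?_).fun_sub
    (hG.const_mul 2)).fun_div hu ?_).congr_deriv ?_
  all_goals simp only [zero_smul, add_zero]
  · positivity
  · exact hu₀
  · rw [h.fderiv_speed, fluxX, ← h.sq_speed]
    field_simp
    ring

lemma IsAdmissible.fderiv_fluxY (h : IsAdmissible f j) (v : Jet) :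
    fderiv ℝ (fluxY f) j v =
      ((fderiv ℝ (curvDensity f) j v * j.q + curvDensity f j * v.q) / (j.s ^ 2 * f j.s)
          - curvDensity f j * j.q * (2 / j.s + deriv f j.s / f j.s) * v.s / (j.s ^ 2 * f j.s)
          + 2 * fderiv ℝ (gaussFluxY f) j v) / speed f j
        - fluxY f j * fderiv ℝ (speedSq f) j v / (2 * speedSq f j) := by
  refine fderiv_eq_of_hasLineDerivAt (h.contDiffAt_fluxY.differentiableAt (by simp)) ?_
  have hs₀ := h.s_pos.ne'
  have hf₀ := h.profile_pos.ne'
  have hu₀ := h.speed_pos.ne'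
  have hs := hasLineDerivAt_apply j v 0
  have hq := hasLineDerivAt_apply j v 2
  have hf := h.hasLineDerivAt_profile v
  have hJ := hasLineDerivAt_fderiv h.contDiffAt_curvDensity v
  have hG := hasLineDerivAt_fderiv h.contDiffAt_gaussFluxY v
  have hu := hasLineDerivAt_fderiv h.contDiffAt_speed v
  unfold HasLineDerivAt at *
  refine ((((hJ.fun_mul hq).fun_div ((hs.fun_pow 2).fun_mul hf) ?_).fun_add
    (hG.const_mul 2)).fun_div hu ?_).congr_deriv ?_
  all_goals simp only [zero_smul, add_zero]
  · positivity
  · exact hu₀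
  · rw [h.fderiv_speed, fluxY, ← h.sq_speed]
    field_simp
    ring

end Linearization

variable (f j) in
/-- The jet of the function obtained by evaluating `speedSq` along the jets of a function with
jet `j` and third derivatives `d`. -/
def speedSqJet (d : Fin 4 → ℝ) : Jet :=
  ![speedSq f j, fderiv ℝ (speedSq f) j (j.totalX d), fderiv ℝ (speedSq f) j (j.totalY d),
    fderiv ℝ (fderiv ℝ (speedSq f)) j (j.totalX d) (j.totalX d)
      + fderiv ℝ (speedSq f) j ![j.a, d 0, d 1, 0, 0, 0],
    fderiv ℝ (fderiv ℝ (speedSq f)) j (j.totalY d) (j.totalX d)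
      + fderiv ℝ (speedSq f) j ![j.b, d 1, d 2, 0, 0, 0],
    fderiv ℝ (fderiv ℝ (speedSq f)) j (j.totalY d) (j.totalY d)
      + fderiv ℝ (speedSq f) j ![j.c, d 2, d 3, 0, 0, 0]]

/-- The Gauss equation, with the Gauss curvature of the graph written as a divergence. -/
theorem IsAdmissible.gaussBonnet_identity (h : IsAdmissible f j) (d : Fin 4 → ℝ) :
    fderiv ℝ (gaussFluxY f) j (j.totalY d) - fderiv ℝ (gaussFluxX f) j (j.totalX d)
        - fderiv ℝ (speedSq f) j (j.totalY d) / (2 * speedSq f j) * gaussFluxY f j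
        + fderiv ℝ (speedSq f) j (j.totalX d) / (2 * speedSq f j) * gaussFluxX f j
      = hessDet f j / (j.s ^ 4 * speedSq f j) - j.s * deriv f j.s * speedSq f j / 2
        + (deriv f j.s / (2 * j.s) - deriv (deriv f) j.s / 2) * j.p ^ 2 / j.s ^ 2 := by
  have hs := h.s_pos
  have hf := h.profile_pos
  have hN : j.s ^ 2 * f j.s + j.p ^ 2 ≠ 0 := by positivity
  have hD : f j.s * (j.s ^ 2 * f j.s + j.p ^ 2) + j.s ^ 2 * j.q ^ 2 ≠ 0 := by positivity
  rw [h.fderiv_gaussFluxX, h.fderiv_gaussFluxY, h.fderiv_hessXX, h.fderiv_hessXY,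
    h.fderiv_speedSq, h.fderiv_speedSq]
  simp only [gaussFluxX, gaussFluxY, hessDet, hessXX, hessXY, hessYY, totalX, totalY,
    h.speedSq_eq_div, Matrix.cons_val]
  generalize deriv (deriv f) j.s = f₂ at *
  generalize deriv f j.s = f₁ at *
  generalize f j.s = f₀ at *
  generalize hNq : j.s ^ 2 * f₀ + j.p ^ 2 = N at *
  field_simp
  subst hNq
  ring

/-- The quotient by `speedSq` is, up to the factor `speed`, the divergence of `curvDensity` times
the tangential part of the reparametrized flow. -/
theorem IsAdmissible.firstVariation_identity (h : IsAdmissible f j) (d : Fin 4 → ℝ) :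
    fderiv ℝ (curvDensity f) j (relSqrt (speedSqJet f j d))
      = (fderiv ℝ (curvDensity f) j (j.totalX d) * j.p / j.s ^ 4
          + fderiv ℝ (curvDensity f) j (j.totalY d) * j.q / (j.s ^ 2 * f j.s)
          + curvDensity f j * ((j.a - 4 * j.p ^ 2 / j.s
              - j.p * fderiv ℝ (speedSq f) j (j.totalX d) / (2 * speedSq f j)) / j.s ^ 4
            + (j.c - (2 / j.s + deriv f j.s / f j.s) * j.q ^ 2
              - j.q * fderiv ℝ (speedSq f) j (j.totalY d) / (2 * speedSq f j))
              / (j.s ^ 2 * f j.s)))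
          / speedSq f j
        + 2 * hessDet f j / (j.s ^ 4 * speedSq f j ^ 2)
        + j.s * deriv f j.s + j.s ^ 2 * deriv (deriv f) j.s / 2 + f j.s
        + ((deriv f j.s / j.s - deriv (deriv f) j.s / 2 - 3 * f j.s / j.s ^ 2) * j.p ^ 2
          - 2 * j.q ^ 2) / (j.s ^ 2 * speedSq f j) := by
  have hs := h.s_pos
  have hf := h.profile_pos
  have hD : f j.s * (j.s ^ 2 * f j.s + j.p ^ 2) + j.s ^ 2 * j.q ^ 2 ≠ 0 := by positivity
  simp only [h.fderiv_curvDensity, h.fderiv_hessTrace, h.fderiv_hessXX, h.fderiv_hessXY,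
    h.fderiv_hessYY, h.fderiv_fderiv_speedSq, h.fderiv_speedSq, curvDensity, hessTrace, relSqrt,
    speedSqJet, hessDet, hessXX, hessXY, hessYY, totalX, totalY,
    h.speedSq_eq_div, Matrix.cons_val]
  generalize deriv (deriv f) j.s = f₂ at *
  generalize deriv f j.s = f₁ at *
  generalize f j.s = f₀ at *
  generalize hDq : f₀ * (j.s ^ 2 * f₀ + j.p ^ 2) + j.s ^ 2 * j.q ^ 2 = D at *
  field_simp
  subst hDq
  ring

theorem IsAdmissible.fderiv_curvDensity_speed_smul (h : IsAdmissible f j) (d : Fin 4 → ℝ) :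
    fderiv ℝ (curvDensity f) j (speed f j • relSqrt (speedSqJet f j d))
      = fderiv ℝ (fluxX f) j (j.totalX d) + fderiv ℝ (fluxY f) j (j.totalY d)
        + reaction f j := by
  have hs := h.s_pos.ne'
  have hf := h.profile_pos.ne'
  have hu := h.speed_pos.ne'
  have hGB := h.gaussBonnet_identity d
  rw [map_smul, smul_eq_mul, h.firstVariation_identity, h.fderiv_fluxX, h.fderiv_fluxY, fluxX,
    fluxY, reaction, ← h.sq_speed]
  rw [← h.sq_speed] at hGB
  generalize fderiv ℝ (gaussFluxX f) j (j.totalX d) = gx at *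
  have hgx : gx = fderiv ℝ (gaussFluxY f) j (j.totalY d)
        - fderiv ℝ (speedSq f) j (j.totalY d) / (2 * speed f j ^ 2) * gaussFluxY f j
        + fderiv ℝ (speedSq f) j (j.totalX d) / (2 * speed f j ^ 2) * gaussFluxX f j
      - (hessDet f j / (j.s ^ 4 * speed f j ^ 2) - j.s * deriv f j.s * speed f j ^ 2 / 2
        + (deriv f j.s / (2 * j.s) - deriv (deriv f) j.s / 2) * j.p ^ 2 / j.s ^ 2) := by
    linear_combination -hGB
  rw [hgx]
  simp only [totalX, totalY, Matrix.cons_val]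
  field_simp
  ring

end Jet

/-! ### Jets of functions -/

section JetsOfFunctions

variable {n m : ℕ}

lemma pd_comp {φ : (Fin m → ℝ) → ℝ} {g : (Fin n → ℝ) → Fin m → ℝ} {p : Fin n → ℝ}
    (hφ : DifferentiableAt ℝ φ (g p)) (hg : DifferentiableAt ℝ g p) (i : Fin n) :
    pd i (fun q => φ (g q)) p = fderiv ℝ φ (g p) fun c => pd i (fun q => g q c) p := by
  rw [pd, fderiv_fun_comp p hφ hg, ContinuousLinearMap.comp_apply]
  congr 1
  ext c
  rw [pd, fderiv_apply hg c]
  rfl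

lemma pd_pd_comp {φ : (Fin m → ℝ) → ℝ} {g : (Fin n → ℝ) → Fin m → ℝ}
    (hφ : ∀ q, ContDiffAt ℝ ∞ φ (g q)) (hg : ContDiff ℝ ∞ g) (i k : Fin n) (p : Fin n → ℝ) :
    pd k (pd i fun q => φ (g q)) p
      = fderiv ℝ (fderiv ℝ φ) (g p) (fun c => pd k (fun q => g q c) p)
          (fun c => pd i (fun q => g q c) p)
        + fderiv ℝ φ (g p) fun c => pd k (pd i fun q => g q c) p := by
  have hpd : ContDiff ℝ ∞ fun q c => pd i (fun q => g q c) q :=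
    contDiff_pi.2 fun c => contDiff_pd (contDiff_pi.1 hg c) i
  have hφ' : DifferentiableAt ℝ (fderiv ℝ φ) (g p) :=
    ((hφ p).fderiv_right (m := 1) (by decide)).differentiableAt (by simp)
  have hgp : DifferentiableAt ℝ g p := (hg.differentiable (by simp)).differentiableAt
  have hfirst : (pd i fun q => φ (g q))
      = fun q => fderiv ℝ φ (g q) fun c => pd i (fun q => g q c) q :=
    funext fun q => pd_comp ((hφ q).differentiableAt (by simp))
      (hg.differentiable (by simp)).differentiableAt i
  have hpdp := (hpd.differentiable (by simp)).differentiableAt (x := p)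
  rw [hfirst, pd, fderiv_clm_apply (c := fun q => fderiv ℝ φ (g q)) (hφ'.comp p hgp) hpdp,
    fderiv_fun_comp p hφ' hgp]
  have hcomp : ∀ {G : (Fin n → ℝ) → Fin m → ℝ}, DifferentiableAt ℝ G p →
      fderiv ℝ G p (Pi.single k 1) = fun c => pd k (fun q => G q c) p := by
    intro G hG
    ext c
    rw [pd, fderiv_apply hG c]
    rfl
  simp [hcomp hpdp, hcomp hgp, add_comm]

lemma pd_sqrt {g : (Fin n → ℝ) → ℝ} {p : Fin n → ℝ} (hg : DifferentiableAt ℝ g p)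
    (hp : g p ≠ 0) (i : Fin n) : pd i (fun q => √(g q)) p = pd i g p / (2 * √(g p)) := by
  simp [pd, fderiv_sqrt hg hp, div_eq_inv_mul]

lemma pd_pd_sqrt {g : (Fin n → ℝ) → ℝ} (hg : ContDiff ℝ ∞ g) (hpos : ∀ q, 0 < g q)
    (i k : Fin n) (p : Fin n → ℝ) :
    pd k (pd i fun q => √(g q)) p
      = √(g p) * (pd k (pd i g) p / (2 * g p) - pd i g p * pd k g p / (4 * g p ^ 2)) := by
  have hd : Differentiable ℝ g := hg.differentiable (by simp)
  have hd' : Differentiable ℝ (pd i g) := (contDiff_pd hg i).differentiable (by simp)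
  have hfirst : (pd i fun q => √(g q)) = fun q => pd i g q / (2 * √(g q)) :=
    funext fun q => pd_sqrt hd.differentiableAt (hpos q).ne' i
  have hsq : √(g p) ^ 2 = g p := Real.sq_sqrt (hpos p).le
  have hr : 0 < √(g p) := Real.sqrt_pos.2 (hpos p)
  have hden : 2 * √(g p) ≠ 0 := by positivity
  have hsqrt : DifferentiableAt ℝ (fun q => √(g q)) p := (hd p).sqrt (hpos p).ne'
  have hdiff : DifferentiableAt ℝ (fun q => pd i g q / (2 * √(g q))) p := by
    fun_prop (disch := assumption)
  have hi := (hd' p).hasFDerivAt.hasLineDerivAt (Pi.single k (1 : ℝ))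
  have hk := (hd p).hasFDerivAt.hasLineDerivAt (Pi.single k (1 : ℝ))
  rw [hfirst, pd]
  refine fderiv_eq_of_hasLineDerivAt hdiff ?_
  unfold HasLineDerivAt at *
  refine (hi.fun_div ((hk.sqrt (by simpa using (hpos p).ne')).const_mul 2) ?_).congr_deriv ?_
  all_goals simp only [zero_smul, add_zero]
  · exact hden
  · rw [pd, pd, pd, ← hsq, Real.sqrt_sq hr.le]
    field_simp
    ring

variable {s : (Fin 2 → ℝ) → ℝ}

/-- The two-jet of `s` at `p`. -/
def jet (s : (Fin 2 → ℝ) → ℝ) (p : Fin 2 → ℝ) : Jet :=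
  ![s p, pd 0 s p, pd 1 s p, pd 0 (pd 0 s) p, pd 1 (pd 0 s) p, pd 1 (pd 1 s) p]

/-- The third derivatives `(s_xxx, s_xxy, s_xyy, s_yyy)` of `s` at `p`. -/
def thirdDerivs (s : (Fin 2 → ℝ) → ℝ) (p : Fin 2 → ℝ) : Fin 4 → ℝ :=
  ![pd 0 (pd 0 (pd 0 s)) p, pd 1 (pd 0 (pd 0 s)) p, pd 1 (pd 1 (pd 0 s)) p,
    pd 1 (pd 1 (pd 1 s)) p]

lemma contDiff_jet (hs : ContDiff ℝ ∞ s) : ContDiff ℝ ∞ (jet s) := by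
  have h : ∀ {g}, ContDiff ℝ ∞ g → ∀ i : Fin 2, ContDiff ℝ ∞ (pd i g) := contDiff_pd
  refine contDiff_pi.2 fun k => ?_
  fin_cases k
  exacts [hs, h hs 0, h hs 1, h (h hs 0) 0, h (h hs 0) 1, h (h hs 1) 1]

lemma contDiff_comp_jet {ψ : Jet → ℝ} (hs : ContDiff ℝ ∞ s)
    (hψ : ∀ p, ContDiffAt ℝ ∞ ψ (jet s p)) : ContDiff ℝ ∞ fun p => ψ (jet s p) :=
  contDiff_iff_contDiffAt.2 fun p => (hψ p).comp p (contDiff_jet hs).contDiffAt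

lemma periodic_jet {s : (Fin 2 → ℝ) → ℝ} {c : Fin 2 → ℝ} (hs : Function.Periodic s c) :
    Function.Periodic (jet s) c := by
  intro p
  have hs' := periodic_pd hs
  simp only [jet, hs p, hs' _ p, periodic_pd (hs' _) _ p]

lemma pd_zero_jet (hs : ContDiff ℝ ∞ s) (p : Fin 2 → ℝ) :
    (fun c => pd 0 (fun q => jet s q c) p) = (jet s p).totalX (thirdDerivs s p) := by
  ext c
  fin_cases c
  · rfl
  · rfl
  · exact congrFun (pd_comm hs 0 1) p
  · rfl
  · exact congrFun (pd_comm (contDiff_pd hs 0) 0 1) p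
  · change pd 0 (pd 1 (pd 1 s)) p = pd 1 (pd 1 (pd 0 s)) p
    rw [pd_comm (contDiff_pd hs 1), pd_comm hs 0 1]

lemma pd_one_jet (p : Fin 2 → ℝ) :
    (fun c => pd 1 (fun q => jet s q c) p) = (jet s p).totalY (thirdDerivs s p) := by
  ext c
  fin_cases c <;> rfl

lemma jet_sqrt {g : (Fin 2 → ℝ) → ℝ} (hg : ContDiff ℝ ∞ g) (hpos : ∀ q, 0 < g q)
    (p : Fin 2 → ℝ) : jet (fun q => √(g q)) p = √(g p) • Jet.relSqrt (jet g p) := by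
  have hd : Differentiable ℝ g := hg.differentiable (by simp)
  have hsq : √(g p) ^ 2 = g p := Real.sq_sqrt (hpos p).le
  have hr : 0 < √(g p) := Real.sqrt_pos.2 (hpos p)
  have hfirst : ∀ i, pd i (fun q => √(g q)) p = √(g p) * (pd i g p / (2 * g p)) := fun i => by
    rw [pd_sqrt hd.differentiableAt (hpos p).ne' i, ← hsq, Real.sqrt_sq hr.le]
    field_simp
  simp only [jet, hfirst, pd_pd_sqrt hg hpos, Jet.relSqrt]
  simp [sq]

variable {f : ℝ → ℝ}

lemma jet_speedSq (hs : ContDiff ℝ ∞ s) (hadm : ∀ q, Jet.IsAdmissible f (jet s q))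
    (p : Fin 2 → ℝ) :
    jet (fun q => Jet.speedSq f (jet s q)) p = Jet.speedSqJet f (jet s p) (thirdDerivs s p) := by
  have hφ : ∀ q, ContDiffAt ℝ ∞ (Jet.speedSq f) (jet s q) := fun q => (hadm q).contDiffAt_speedSq
  have hd := (contDiff_jet hs).differentiable (by simp)
  have hfst : ∀ v, fderiv ℝ (Jet.speedSq f) (jet s p) v
      = fderiv ℝ (Jet.speedSq f) (jet s p) ![v 0, v 1, v 2, 0, 0, 0] := fun v => by
    simp only [(hadm p).fderiv_speedSq]
    rfl
  have hcomm : ∀ i, pd i (pd 0 (pd 1 s)) p = pd i (pd 1 (pd 0 s)) p := fun i => by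
    rw [pd_comm hs 0 1]
  rw [jet, Jet.speedSqJet]
  simp only [pd_pd_comp hφ (contDiff_jet hs), pd_one_jet, pd_zero_jet hs,
    pd_comp ((hφ p).differentiableAt (by simp)) (hd p),
    hfst fun c => pd _ (pd _ fun q => jet s q c) p]
  simp only [jet, thirdDerivs, Matrix.cons_val, hcomm, pd_comm (contDiff_pd hs 0) 0 1]

end JetsOfFunctions

/-! ### Evolution under the flow -/

section Evolution

variable {f : ℝ → ℝ}

lemma jet_speed {s : (Fin 2 → ℝ) → ℝ} (hs : ContDiff ℝ ∞ s)
    (hadm : ∀ q, Jet.IsAdmissible f (jet s q)) (p : Fin 2 → ℝ) :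
    jet (fun q => Jet.speed f (jet s q)) p
      = Jet.speed f (jet s p) • Jet.relSqrt (Jet.speedSqJet f (jet s p) (thirdDerivs s p)) := by
  have hsq : ContDiff ℝ ∞ fun q => Jet.speedSq f (jet s q) :=
    contDiff_comp_jet hs fun q => (hadm q).contDiffAt_speedSq
  rw [← jet_speedSq hs hadm]
  exact jet_sqrt hsq (fun q => (hadm q).speedSq_pos) p

variable {I : Set ℝ} {t : ℝ} {s : ℝ → (Fin 2 → ℝ) → ℝ} (hI : Convex ℝ I)
  (hI' : (interior I).Nonempty)

include hI hI'

protected lemma IsSmoothFamily.jet (hs : IsSmoothFamily I s) :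
    IsSmoothFamily I fun τ => jet (s τ) := by
  have h : ∀ {g}, IsSmoothFamily I g → ∀ i : Fin 2, IsSmoothFamily I fun τ => pd i (g τ) :=
    IsSmoothFamily.pd hI hI'
  refine contDiffOn_pi.2 fun k => ?_
  fin_cases k
  exacts [hs, h hs 0, h hs 1, h (h hs 0) 0, h (h hs 0) 1, h (h hs 1) 1]

lemma IsSmoothFamily.hasDerivWithinAt_jet (hs : IsSmoothFamily I s) (ht : t ∈ I)
    {u : (Fin 2 → ℝ) → ℝ} (hu : ∀ q, HasDerivWithinAt (fun τ => s τ q) (u q) I t)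
    (p : Fin 2 → ℝ) : HasDerivWithinAt (fun τ => jet (s τ) p) (jet u p) I t := by
  have h {g : ℝ → (Fin 2 → ℝ) → ℝ} {g' : (Fin 2 → ℝ) → ℝ} (hg : IsSmoothFamily I g)
      (hg' : ∀ q, HasDerivWithinAt (fun τ => g τ q) (g' q) I t) (i : Fin 2) (q : Fin 2 → ℝ) :
      HasDerivWithinAt (fun τ => pd i (g τ) q) (pd i g' q) I t :=
    hg.hasDerivWithinAt_fderiv hI hI' ht hg' q _
  have hs₁ := hs.pd hI hI'
  refine hasDerivWithinAt_pi.2 fun k => ?_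
  fin_cases k
  exacts [hu p, h hs hu 0 p, h hs hu 1 p, h (hs₁ 0) (h hs hu 0) 0 p, h (hs₁ 0) (h hs hu 0) 1 p,
    h (hs₁ 1) (h hs hu 1) 1 p]

theorem hasDerivWithinAt_curvDensity_jet (hs : IsSmoothFamily I s) (ht : t ∈ I)
    (hadm : ∀ q, Jet.IsAdmissible f (jet (s t) q))
    (hflow : ∀ q, HasDerivWithinAt (fun τ => s τ q) (Jet.speed f (jet (s t) q)) I t)
    (p : Fin 2 → ℝ) :
    HasDerivWithinAt (fun τ => Jet.curvDensity f (jet (s τ) p))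
      (pd 0 (fun q => Jet.fluxX f (jet (s t) q)) p + pd 1 (fun q => Jet.fluxY f (jet (s t) q)) p
        + Jet.reaction f (jet (s t) p)) I t := by
  have hst := hs.contDiff ht
  have hjet := (contDiff_jet hst).differentiable (by simp) p
  have hdiff : ∀ {φ : Jet → ℝ} {j}, ContDiffAt ℝ ∞ φ j → DifferentiableAt ℝ φ j :=
    fun hφ => hφ.differentiableAt (by simp)
  have hevol := (hdiff (hadm p).contDiffAt_curvDensity).hasFDerivAt.comp_hasDerivWithinAt t
    (hs.hasDerivWithinAt_jet hI hI' ht hflow p)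
  rwa [jet_speed hst hadm, (hadm p).fderiv_curvDensity_speed_smul, ← pd_zero_jet hst,
    ← pd_one_jet, ← pd_comp (hdiff (hadm p).contDiffAt_fluxX) hjet,
    ← pd_comp (hdiff (hadm p).contDiffAt_fluxY) hjet] at hevol

end Evolution

/-! ### Integrals over the torus -/

section TorusIntegral

open MeasureTheory Filter Topology

section TimeDerivative

variable {X : Type*} [TopologicalSpace X] {I : Set ℝ} {t : ℝ} {k : Set X} {h h' : ℝ → X → ℝ}

lemma exists_slope_bound_of_isCompact (hk : IsCompact k) (hI : Convex ℝ I) (ht : t ∈ I)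
    (hh' : ContinuousOn (Function.uncurry h') (I ×ˢ k))
    (hd : ∀ τ ∈ I, ∀ x ∈ k, HasDerivWithinAt (fun τ => h τ x) (h' τ x) I τ) :
    ∃ C, ∀ᶠ τ in 𝓝[I \ {t}] t, ∀ x ∈ k, ‖slope (fun τ => h τ x) t τ‖ ≤ C := by
  obtain ⟨C, hC⟩ := hk.exists_bound_of_continuousOn <|
    hh'.comp (Continuous.prodMk_right t).continuousOn fun x hx => Set.mk_mem_prod ht hx
  have hlocal : ∀ᶠ τ in 𝓝 t, ∀ x ∈ k, τ ∈ I → x ∈ k → ‖h' τ x‖ ≤ C + 1 := by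
    refine hk.eventually_forall_of_forall_eventually
      (P := fun τ x => τ ∈ I → x ∈ k → ‖h' τ x‖ ≤ C + 1) fun x hx => ?_
    have hlt : ‖Function.uncurry h' (t, x)‖ < C + 1 := (hC x hx).trans_lt (lt_add_one C)
    filter_upwards [eventually_nhdsWithin_iff.1
      ((hh' (t, x) ⟨ht, hx⟩).norm.eventually (gt_mem_nhds hlt))] with z hz hzI hzk
    exact (hz ⟨hzI, hzk⟩).le
  obtain ⟨δ, hδ, hball⟩ := Metric.eventually_nhds_iff_ball.1 hlocal
  refine ⟨C + 1, ?_⟩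
  filter_upwards [self_mem_nhdsWithin, mem_nhdsWithin_of_mem_nhds (Metric.ball_mem_nhds t hδ)]
    with τ hτ hτδ x hx
  have hle := (hI.inter (convex_ball t δ)).norm_image_sub_le_of_norm_hasDerivWithin_le
    (fun z hz => (hd z hz.1 x hx).mono Set.inter_subset_left)
    (fun z hz => hball z hz.2 x hx hz.1 hx) ⟨ht, Metric.mem_ball_self hδ⟩ ⟨hτ.1, hτδ⟩
  rwa [slope_def_field, norm_div, div_le_iff₀ (norm_pos_iff.2 (sub_ne_zero.2 hτ.2))]

lemma hasDerivWithinAt_setIntegral_of_isCompact [T2Space X] [MeasurableSpace X]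
    [OpensMeasurableSpace X] {μ : Measure X} [IsFiniteMeasureOnCompacts μ]
    (hk : IsCompact k) (hI : Convex ℝ I) (ht : t ∈ I) (hh : ∀ τ ∈ I, ContinuousOn (h τ) k)
    (hh' : ContinuousOn (Function.uncurry h') (I ×ˢ k))
    (hd : ∀ τ ∈ I, ∀ x ∈ k, HasDerivWithinAt (fun τ => h τ x) (h' τ x) I τ) :
    HasDerivWithinAt (fun τ => ∫ x in k, h τ x ∂μ) (∫ x in k, h' t x ∂μ) I t := by
  have hint : ∀ τ ∈ I, IntegrableOn (h τ) k μ := fun τ hτ => (hh τ hτ).integrableOn_compact hk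
  obtain ⟨C, hC⟩ := exists_slope_bound_of_isCompact hk hI ht hh' hd
  rw [hasDerivWithinAt_iff_tendsto_slope]
  have hslope : ∀ᶠ τ in 𝓝[I \ {t}] t, ∫ x in k, slope (fun τ => h τ x) t τ ∂μ
      = slope (fun τ => ∫ x in k, h τ x ∂μ) t τ := by
    filter_upwards [self_mem_nhdsWithin] with τ hτ
    simp only [slope_def_field]
    rw [integral_div, integral_sub (hint τ hτ.1) (hint t ht)]
  refine (tendsto_integral_filter_of_dominated_convergence (fun _ => C) ?_ ?_ ?_ ?_).congr' hslope
  · filter_upwards [self_mem_nhdsWithin] with τ hτ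
    simp only [slope_def_field]
    exact (((hint τ hτ.1).sub (hint t ht)).div_const _).aestronglyMeasurable
  · filter_upwards [hC] with τ hτ
    exact ae_restrict_of_forall_mem hk.measurableSet hτ
  · exact (continuousOn_const (c := C)).integrableOn_compact hk
  · exact ae_restrict_of_forall_mem hk.measurableSet fun x hx =>
      hasDerivWithinAt_iff_tendsto_slope.1 (hd t ht x hx)

end TimeDerivative

/-- The integral of a function on the torus `∏ i, ℝ / P i ℤ`, over the fundamental domain
`∏ i, [0, P i]`. -/
def torusIntegral {n : ℕ} (P : Fin n → ℝ) (g : (Fin n → ℝ) → ℝ) : ℝ := ∫ p in Set.Icc 0 P, g p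

section Periodic

variable {n : ℕ} {P : Fin n → ℝ} {g : (Fin n → ℝ) → ℝ}

lemma torusIntegral_add {h : (Fin n → ℝ) → ℝ} (hg : Continuous g)
    (hh : Continuous h) :
    torusIntegral P (fun p => g p + h p) = torusIntegral P g + torusIntegral P h :=
  integral_add hg.integrableOn_Icc hh.integrableOn_Icc

lemma torusIntegral_sub {h : (Fin n → ℝ) → ℝ} (hg : Continuous g)
    (hh : Continuous h) :
    torusIntegral P (fun p => g p - h p) = torusIntegral P g - torusIntegral P h :=
  integral_sub hg.integrableOn_Icc hh.integrableOn_Icc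

lemma torusIntegral_const_mul (c : ℝ) :
    torusIntegral P (fun p => c * g p) = c * torusIntegral P g :=
  integral_const_mul c _

lemma IsSmoothFamily.hasDerivWithinAt_torusIntegral {I : Set ℝ} {t : ℝ} (hI : Convex ℝ I)
    (hI' : (interior I).Nonempty) {h : ℝ → (Fin n → ℝ) → ℝ} (hh : IsSmoothFamily I h) (ht : t ∈ I)
    {h' : (Fin n → ℝ) → ℝ} (hd : ∀ p, HasDerivWithinAt (fun τ => h τ p) (h' p) I t) :
    HasDerivWithinAt (fun τ => torusIntegral P (h τ)) (torusIntegral P h') I t := by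
  have hint := hasDerivWithinAt_setIntegral_of_isCompact (μ := volume)
    (h' := fun τ p => fderivWithin ℝ (fun z : ℝ × (Fin n → ℝ) => h z.1 z.2) (I ×ˢ Set.univ)
      (τ, p) (1, 0)) (isCompact_Icc (a := 0) (b := P)) hI ht
    (fun τ hτ => (hh.contDiff hτ).continuous.continuousOn)
    ((hh.fderivWithin_apply hI hI' (1, 0)).continuousOn.mono
      (Set.prod_mono_right (Set.subset_univ _)))
    fun τ hτ p _ => hh.hasDerivWithinAt hτ p
  have heq : h' = fun p => fderivWithin ℝ (fun z : ℝ × (Fin n → ℝ) => h z.1 z.2) (I ×ˢ Set.univ)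
      (t, p) (1, 0) :=
    funext fun p => (uniqueDiffOn_convex hI hI' t ht).eq_deriv _ (hd p) (hh.hasDerivWithinAt ht p)
  rwa [heq]

lemma torusIntegral_sum_pd_eq_zero {Y : Fin n → (Fin n → ℝ) → ℝ} (hP : 0 ≤ P)
    (hY : ∀ i, ContDiff ℝ ∞ (Y i)) (hper : ∀ i, Function.Periodic (Y i) (Pi.single i (P i))) :
    torusIntegral P (fun p => ∑ i, pd i (Y i) p) = 0 := by
  cases n with
  | zero => simp [torusIntegral]
  | succ n =>
    have hcont : Continuous fun p => ∑ i, pd i (Y i) p :=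
      continuous_finsetSum _ fun i _ => (contDiff_pd (hY i) i).continuous
    have hdiv := integral_divergence_of_hasFDerivAt_off_countable' 0 P hP Y
      (fun i => fderiv ℝ (Y i)) ∅ Set.countable_empty (fun i => (hY i).continuous.continuousOn)
      (fun p _ i => ((hY i).differentiable (by simp) p).hasFDerivAt)
      (hcont.continuousOn.integrableOn_compact isCompact_Icc)
    refine hdiv.trans (Finset.sum_eq_zero fun i _ => sub_eq_zero.2 (integral_congr_ae ?_))
    refine Eventually.of_forall fun p => ?_
    have hface : i.insertNth (α := fun _ => ℝ) (P i) p
        = i.insertNth (α := fun _ => ℝ) 0 p + Pi.single i (P i) := by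
      ext k
      refine Fin.succAboveCases i ?_ (fun k => ?_) k <;> simp
    simp only [hface, hper i _, Pi.zero_apply]

lemma torusIntegral_pd_zero_add_pd_one {Px Py : ℝ} (hPx : 0 ≤ Px) (hPy : 0 ≤ Py)
    {g h : (Fin 2 → ℝ) → ℝ} (hg : ContDiff ℝ ∞ g) (hh : ContDiff ℝ ∞ h)
    (hg' : Function.Periodic g (Pi.single 0 Px)) (hh' : Function.Periodic h (Pi.single 1 Py)) :
    torusIntegral ![Px, Py] (fun p => pd 0 g p + pd 1 h p) = 0 := by
  have hdiv := torusIntegral_sum_pd_eq_zero (P := ![Px, Py]) (Y := ![g, h])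
    (by simp [Pi.le_def, Fin.forall_fin_two, hPx, hPy]) (Fin.forall_fin_two.2 ⟨hg, hh⟩)
    (Fin.forall_fin_two.2 ⟨hg', hh'⟩)
  simp only [Fin.sum_univ_two] at hdiv
  exact hdiv

lemma exists_mem_Icc_eq_of_periodic (hP : ∀ i, 0 < P i)
    (hper : ∀ i, Function.Periodic g (Pi.single i (P i))) (p : Fin n → ℝ) :
    ∃ q ∈ Set.Icc 0 P, g q = g p := by
  choose m hm _ using fun i => existsUnique_add_zsmul_mem_Ico (hP i) (p i) 0
  have hsum : Function.Periodic g (∑ i, m i • (Pi.single i (P i) : Fin n → ℝ)) :=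
    Finset.sum_induction _ (Function.Periodic g) (fun _ _ => Function.Periodic.add_period)
      (by simp [Function.Periodic]) fun i _ => (hper i).zsmul (m i)
  have hcoord : ∀ i, (p + ∑ k, m k • (Pi.single k (P k) : Fin n → ℝ)) i = p i + m i • P i := by
    simp [Finset.sum_apply, Pi.single_apply]
  refine ⟨_, ⟨fun i => ?_, fun i => ?_⟩, hsum p⟩
  · rw [hcoord]
    exact (hm i).1
  · rw [hcoord]
    simpa using (hm i).2.le

lemma torusIntegral_eq_zero_iff (hP : ∀ i, 0 < P i) (hg : Continuous g) (hg₀ : ∀ p, 0 ≤ g p)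
    (hper : ∀ i, Function.Periodic g (Pi.single i (P i))) :
    torusIntegral P g = 0 ↔ ∀ p, g p = 0 := by
  refine ⟨fun h => ?_, fun h => by simp [torusIntegral, h]⟩
  have hae : g =ᵐ[volume.restrict (Set.Icc 0 P)] 0 :=
    (setIntegral_eq_zero_iff_of_nonneg_ae (Eventually.of_forall hg₀)
      (hg.continuousOn.integrableOn_compact isCompact_Icc)).1 h
  have hbox : Set.Icc 0 P ⊆ closure (interior (Set.Icc 0 P)) := by
    have hint : (interior (Set.Icc 0 P)).Nonempty := by
      rw [← Set.pi_univ_Icc, interior_pi_set Set.finite_univ]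
      simpa [Set.univ_pi_nonempty_iff] using hP
    rw [(convex_Icc (𝕜 := ℝ) (0 : Fin n → ℝ) P)
      |>.closure_interior_eq_closure_of_nonempty_interior hint]
    exact subset_closure
  have hzero := Measure.eqOn_of_ae_eq hae hg.continuousOn continuousOn_const hbox
  intro p
  obtain ⟨q, hq, hqp⟩ := exists_mem_Icc_eq_of_periodic hP hper p
  exact hqp.symm.trans (hzero hq)

end Periodic

lemma intervalIntegral_eq_torusIntegral {Px Py : ℝ} (hPx : 0 ≤ Px) (hPy : 0 ≤ Py)
    {g : (Fin 2 → ℝ) → ℝ} (hg : Continuous g) :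
    ∫ x in (0 : ℝ)..Px, ∫ y in (0 : ℝ)..Py, g ![x, y] = torusIntegral ![Px, Py] g := by
  have hpair : Continuous fun z => g (MeasurableEquiv.finTwoArrow.symm z) :=
    hg.comp (continuous_pi (Fin.forall_fin_two.2 ⟨continuous_fst, continuous_snd⟩))
  have hbox : MeasurableEquiv.finTwoArrow.symm ⁻¹' Set.Icc 0 ![Px, Py]
      = Set.Icc 0 Px ×ˢ Set.Icc 0 Py := by
    ext z
    simp [Pi.le_def, Fin.forall_fin_two, Prod.le_def, and_and_and_comm]
  rw [torusIntegral, ← (volume_preserving_finTwoArrow ℝ).symm.setIntegral_preimage_emb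
    MeasurableEquiv.finTwoArrow.symm.measurableEmbedding, hbox, Measure.volume_eq_prod,
    setIntegral_prod _ (hpair.continuousOn.integrableOn_compact (isCompact_Icc.prod isCompact_Icc))]
  simp only [intervalIntegral.integral_of_le hPx, intervalIntegral.integral_of_le hPy,
    integral_Icc_eq_integral_Ioc]
  rfl

end TorusIntegral

/-! ### Graphs in the ambient metric -/

section Graphs

/-- The metric `f(r)⁻¹ dr² + r² dx² + f(r) dy²`. -/
def profileMetric (f : ℝ → ℝ) (p : Fin 3 → ℝ) : Matrix (Fin 3) (Fin 3) ℝ :=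
  Matrix.diagonal ![(f (p 0))⁻¹, p 0 ^ 2, f (p 0)]

lemma pd_comp_apply {n : ℕ} (i k : Fin n) {g : ℝ → ℝ} {g' : ℝ} {p : Fin n → ℝ}
    (hg : HasDerivAt g g' (p k)) : pd i (fun q => g (q k)) p = if i = k then g' else 0 := by
  have h := hg.comp_hasFDerivAt p (hasFDerivAt_apply (𝕜 := ℝ) k p)
  refine (congrArg (fun L : (Fin n → ℝ) →L[ℝ] ℝ => L (Pi.single i 1)) h.fderiv).trans ?_
  simp [Pi.single_apply, eq_comm]

lemma pd_const {n : ℕ} (i : Fin n) (c : ℝ) (p : Fin n → ℝ) : pd i (fun _ => c) p = 0 := by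
  simp [pd]

variable {f : ℝ → ℝ}

lemma det_profileMetric {p : Fin 3 → ℝ} (hf : f (p 0) ≠ 0) :
    (profileMetric f p).det = p 0 ^ 2 := by
  simp only [profileMetric, Matrix.det_diagonal, Fin.prod_univ_three, Matrix.cons_val]
  field_simp

lemma inv_profileMetric {p : Fin 3 → ℝ} (hp : p 0 ≠ 0) (hf : f (p 0) ≠ 0) :
    (profileMetric f p)⁻¹ = Matrix.diagonal ![f (p 0), (p 0 ^ 2)⁻¹, (f (p 0))⁻¹] := by
  refine Matrix.inv_eq_right_inv ?_
  rw [profileMetric, Matrix.diagonal_mul_diagonal, ← Matrix.diagonal_one]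
  congr 1
  ext i
  fin_cases i <;> simp [hf, hp]

lemma pd_profileMetric {p : Fin 3 → ℝ} (hd : DifferentiableAt ℝ f (p 0)) (hf : f (p 0) ≠ 0)
    (a i k : Fin 3) :
    pd a (fun q => profileMetric f q i k) p =
      if i = k ∧ a = 0 then
        ![-deriv f (p 0) / f (p 0) ^ 2, 2 * p 0, deriv f (p 0)] i else 0 := by
  simp only [profileMetric, Matrix.diagonal_apply]
  by_cases hik : i = k
  · subst hik
    simp only [true_and, if_true]
    fin_cases i
    · exact pd_comp_apply a 0 (hd.hasDerivAt.fun_inv hf)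
    · simpa using pd_comp_apply a 0 (hasDerivAt_pow 2 (p 0))
    · exact pd_comp_apply a 0 hd.hasDerivAt
  · simp [hik, pd_const]

lemma christoffel_profileMetric {p : Fin 3 → ℝ} (hp : p 0 ≠ 0) (hf : f (p 0) ≠ 0)
    (c i k : Fin 3) :
    christoffel (profileMetric f) p c i k = (1 / 2) *
      (![f (p 0), (p 0 ^ 2)⁻¹, (f (p 0))⁻¹] c *
        (pd i (fun q => profileMetric f q k c) p + pd k (fun q => profileMetric f q i c) p
          - pd c (fun q => profileMetric f q i k) p)) := by
  rw [christoffel, inv_profileMetric hp hf, Finset.sum_eq_single c]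
  · rw [Matrix.diagonal_apply_eq]
  · intro d _ hd
    rw [Matrix.diagonal_apply_ne _ hd.symm, zero_mul]
  · simp

lemma tangentVec_graphMap (s : (Fin 2 → ℝ) → ℝ) (i : Fin 2) (u : Fin 2 → ℝ) :
    tangentVec (graphMap s) i u = ![pd i s u, if i = 0 then 1 else 0, if i = 1 then 1 else 0] := by
  ext a
  fin_cases a
  · rfl
  · exact pd_comp_apply i 0 (hasDerivAt_id _)
  · exact pd_comp_apply i 1 (hasDerivAt_id _)

lemma pd_tangentVec_graphMap (s : (Fin 2 → ℝ) → ℝ) (i k : Fin 2) (u : Fin 2 → ℝ) (c : Fin 3) :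
    pd i (fun w => tangentVec (graphMap s) k w c) u = ![pd i (pd k s) u, 0, 0] c := by
  simp only [tangentVec_graphMap]
  fin_cases c
  · rfl
  · exact pd_const _ _ _
  · exact pd_const _ _ _

variable {s : (Fin 2 → ℝ) → ℝ} {u : Fin 2 → ℝ}

lemma firstForm_graphMap :
    firstForm (profileMetric f) (graphMap s) u =
      !![s u ^ 2 + pd 0 s u ^ 2 / f (s u), pd 0 s u * pd 1 s u / f (s u);
        pd 0 s u * pd 1 s u / f (s u), f (s u) + pd 1 s u ^ 2 / f (s u)] := by
  ext i k
  simp only [firstForm, metricInner, tangentVec_graphMap, profileMetric, graphMap,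
    Fin.sum_univ_three]
  fin_cases i <;> fin_cases k <;> simp <;> ring

lemma det_firstForm_graphMap (hs : s u ≠ 0) (hf : f (s u) ≠ 0) :
    (firstForm (profileMetric f) (graphMap s) u).det
      = (s u ^ 2) ^ 2 * Jet.speedSq f (jet s u) := by
  rw [firstForm_graphMap, Matrix.det_fin_two_of]
  simp only [Jet.speedSq, jet, Matrix.cons_val]
  field_simp
  ring

lemma metricInner_inv_conormal (hs : s u ≠ 0) (hf : f (s u) ≠ 0) :
    metricInner (profileMetric f (graphMap s u))⁻¹ (conormal s u) (conormal s u)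
      = s u ^ 2 * Jet.speedSq f (jet s u) := by
  rw [inv_profileMetric hs hf]
  simp only [metricInner, conormal, Fin.sum_univ_three, graphMap, Matrix.diagonal_apply,
    Jet.speedSq, jet, Matrix.cons_val]
  simp only [Fin.reduceEq, if_true, if_false, zero_mul, add_zero, zero_add]
  field_simp

lemma metricInner_eq_dotProduct {n : ℕ} (G : Matrix (Fin n) (Fin n) ℝ) (v w : Fin n → ℝ) :
    metricInner G v w = v ⬝ᵥ G.mulVec w := by
  simp only [metricInner, dotProduct, Matrix.mulVec, Finset.mul_sum]
  exact Finset.sum_congr rfl fun _ _ => Finset.sum_congr rfl fun _ _ => by ring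

lemma covTangent_dotProduct_conormal (hs : s u ≠ 0) (hd : DifferentiableAt ℝ f (s u))
    (hf : f (s u) ≠ 0) (hsymm : pd 0 (pd 1 s) u = pd 1 (pd 0 s) u) (i k : Fin 2) :
    covTangent (profileMetric f) (graphMap s) i k u ⬝ᵥ conormal s u =
      !![Jet.hessXX f (jet s u), Jet.hessXY f (jet s u);
        Jet.hessXY f (jet s u), Jet.hessYY f (jet s u)] i k := by
  simp only [covTangent, christoffel_profileMetric (p := graphMap s u) hs hf,
    pd_profileMetric (p := graphMap s u) hd hf, pd_tangentVec_graphMap, dotProduct,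
    Fin.sum_univ_three, conormal]
  rw [show graphMap s u 0 = s u from rfl, tangentVec_graphMap, tangentVec_graphMap]
  fin_cases i <;> fin_cases k <;>
    simp [Jet.hessXX, Jet.hessXY, Jet.hessYY, jet, hsymm] <;> field_simp <;> ring

end Graphs

/-! ### The AdS-Melvin space -/

section AdSMelvinSpace

/-- The function `f = r² F`, for which the AdS-Melvin metric is `f⁻¹ dr² + r² dx² + f dy²`. -/
def profile (b r : ℝ) : ℝ := r ^ 2 * warp b r

variable {b rs r : ℝ}

lemma metric_eq_profileMetric (b : ℝ) : metric b = profileMetric (profile b) := by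
  ext1 p
  rw [metric, profileMetric, profile, mul_inv]

lemma profile_eqOn (b : ℝ) : Set.EqOn (profile b) (fun r => r ^ 2 - 1 / r - b / r ^ 2) {0}ᶜ := by
  intro r (hr : r ≠ 0)
  simp only [profile, warp]
  field_simp

lemma deriv_profile (b : ℝ) (hr : r ≠ 0) :
    deriv (profile b) r = 2 * r + 1 / r ^ 2 + 2 * b / r ^ 3 := by
  rw [(profile_eqOn b).deriv isOpen_compl_singleton hr]
  have h₁ := (hasDerivAt_id r).fun_inv hr
  have h₂ := (hasDerivAt_pow 2 r).fun_inv (pow_ne_zero 2 hr)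
  simp only [one_div, div_eq_mul_inv b]
  refine (((hasDerivAt_pow 2 r).sub h₁).sub (h₂.const_mul b)).deriv.trans ?_
  norm_num
  field_simp
  ring

lemma deriv_deriv_profile (b : ℝ) (hr : r ≠ 0) :
    deriv (deriv (profile b)) r = 2 - 2 / r ^ 3 - 6 * b / r ^ 4 := by
  have h : Set.EqOn (deriv (profile b)) _ {0}ᶜ := fun _ => deriv_profile b
  rw [h.deriv isOpen_compl_singleton hr]
  have h₂ := (hasDerivAt_pow 2 r).fun_inv (pow_ne_zero 2 hr)
  have h₃ := (hasDerivAt_pow 3 r).fun_inv (pow_ne_zero 3 hr)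
  simp only [one_div, div_eq_mul_inv (2 * b)]
  refine (((hasDerivAt_const_mul 2).add h₂).add (h₃.const_mul (2 * b))).deriv.trans ?_
  norm_num
  field_simp
  ring

lemma contDiffOn_profile (b : ℝ) : ContDiffOn ℝ ∞ (profile b) (Set.Ioi 0) := by
  intro r hr
  have hr' : r ≠ 0 := ne_of_gt hr
  unfold profile warp
  exact ContDiffAt.contDiffWithinAt (by fun_prop (disch := positivity))

lemma hasDerivAt_warp (b : ℝ) (hr : r ≠ 0) :
    HasDerivAt (warp b) (3 / r ^ 4 + 4 * b / r ^ 5) r := by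
  have h₃ := (hasDerivAt_pow 3 r).fun_inv (pow_ne_zero 3 hr)
  have h₄ := (hasDerivAt_pow 4 r).fun_inv (pow_ne_zero 4 hr)
  refine ((h₃.const_sub 1).sub (h₄.const_mul b)).congr_deriv ?_
  norm_num
  field_simp
  ring

lemma warp_strictMonoOn (hb : 0 ≤ b) : StrictMonoOn (warp b) (Set.Ioi 0) := by
  have hd : ∀ r ∈ Set.Ioi (0 : ℝ), HasDerivAt (warp b) (3 / r ^ 4 + 4 * b / r ^ 5) r :=
    fun r hr => hasDerivAt_warp b (ne_of_gt hr)
  refine strictMonoOn_of_deriv_pos (convex_Ioi 0)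
    (fun r hr => (hd r hr).continuousAt.continuousWithinAt) fun r hr => ?_
  rw [interior_Ioi] at hr
  have hr' : 0 < r := hr
  rw [(hd r hr).deriv]
  positivity

lemma warp_pos (hb : 0 ≤ b) (hrs : IsCoreRadius b rs) (hr : rs < r) : 0 < warp b r :=
  hrs.1.2 ▸ warp_strictMonoOn hb hrs.1.1 (hrs.1.1.trans hr) hr

lemma periodY_pos (hb : 0 ≤ b) (hrs : IsCoreRadius b rs) : 0 < periodY b rs := by
  have hrs₀ : 0 < rs := hrs.1.1
  rw [periodY, (hasDerivAt_warp b hrs₀.ne').deriv]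
  positivity

lemma volumeDensity_metric {p : Fin 3 → ℝ} (hp : 0 ≤ p 0) (hf : profile b (p 0) ≠ 0) :
    volumeDensity (metric b) p = p 0 := by
  rw [volumeDensity, metric_eq_profileMetric, det_profileMetric hf, Real.sqrt_sq hp]

variable {s : (Fin 2 → ℝ) → ℝ} {Px Py : ℝ}

lemma IsHeightFunction.isAdmissible (hs : IsHeightFunction rs Px Py s) (hb : 0 ≤ b)
    (hrs : IsCoreRadius b rs) (p : Fin 2 → ℝ) : Jet.IsAdmissible (profile b) (jet s p) :=
  have hpos : 0 < s p := hrs.1.1.trans (hs.gt_core p)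
  ⟨contDiffOn_profile b, hpos, mul_pos (pow_pos hpos 2) (warp_pos hb hrs (hs.gt_core p))⟩

variable {u : Fin 2 → ℝ}

lemma unitNormal_eq (h : Jet.IsAdmissible (profile b) (jet s u)) :
    unitNormal b s u = (s u * Jet.speed (profile b) (jet s u))⁻¹ •
      (metric b (graphMap s u))⁻¹.mulVec (conormal s u) := by
  have hs : 0 < s u := h.s_pos
  rw [unitNormal, metric_eq_profileMetric, metricInner_inv_conormal hs.ne' h.profile_pos.ne',
    Real.sqrt_mul (sq_nonneg _), Real.sqrt_sq hs.le, Jet.speed]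

lemma unitNormal_dotProduct_conormal (h : Jet.IsAdmissible (profile b) (jet s u)) :
    unitNormal b s u ⬝ᵥ conormal s u = s u * Jet.speed (profile b) (jet s u) := by
  have hs : 0 < s u := h.s_pos
  have hu := h.speed_pos
  rw [unitNormal_eq h, metric_eq_profileMetric, smul_dotProduct, dotProduct_comm,
    ← metricInner_eq_dotProduct, metricInner_inv_conormal hs.ne' h.profile_pos.ne', ← h.sq_speed,
    smul_eq_mul]
  field_simp

lemma secondForm_graphMap (h : Jet.IsAdmissible (profile b) (jet s u))
    (hsymm : pd 0 (pd 1 s) u = pd 1 (pd 0 s) u) :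
    secondForm (metric b) (graphMap s) (unitNormal b s) u =
      -(s u * Jet.speed (profile b) (jet s u))⁻¹ •
        !![Jet.hessXX (profile b) (jet s u), Jet.hessXY (profile b) (jet s u);
          Jet.hessXY (profile b) (jet s u), Jet.hessYY (profile b) (jet s u)] := by
  have hs : s u ≠ 0 := h.s_pos.ne'
  have hf : profile b (s u) ≠ 0 := h.profile_pos.ne'
  have hd : DifferentiableAt ℝ (profile b) (s u) := h.contDiffAt_profile.differentiableAt (by simp)
  have hdet : IsUnit (profileMetric (profile b) (graphMap s u)).det := by
    rw [det_profileMetric hf]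
    exact (pow_ne_zero 2 hs).isUnit
  ext i k
  rw [secondForm, Matrix.of_apply, unitNormal_eq h, metric_eq_profileMetric,
    metricInner_eq_dotProduct, Matrix.mulVec_smul, Matrix.mulVec_mulVec,
    Matrix.mul_nonsing_inv _ hdet, Matrix.one_mulVec, dotProduct_smul,
    covTangent_dotProduct_conormal hs hd hf hsymm, Matrix.smul_apply, neg_smul]

lemma graphMeanCurvature_mul_areaDensity (h : Jet.IsAdmissible (profile b) (jet s u))
    (hsymm : pd 0 (pd 1 s) u = pd 1 (pd 0 s) u) :
    graphMeanCurvature b s u * s u * areaDensity (metric b) (graphMap s) u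
      = Jet.curvDensity (profile b) (jet s u) := by
  have hs : 0 < s u := h.s_pos
  have hu := h.speed_pos
  have hdet := det_firstForm_graphMap hs.ne' h.profile_pos.ne'
  rw [graphMeanCurvature, meanCurvature, areaDensity, secondForm_graphMap h hsymm,
    metric_eq_profileMetric, Matrix.inv_def, hdet, firstForm_graphMap,
    Matrix.adjugate_fin_two_of, Real.sqrt_mul (by positivity), Real.sqrt_sq (by positivity),
    Jet.curvDensity, Jet.hessTrace, ← Jet.speed, ← h.sq_speed]
  simp only [Fin.sum_univ_two, Ring.inverse_eq_inv', Matrix.smul_apply, Matrix.of_apply,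
    Matrix.cons_val', Matrix.cons_val, smul_eq_mul, show (jet s u).s = s u from rfl,
    show (jet s u).p = pd 0 s u from rfl, show (jet s u).q = pd 1 s u from rfl]
  field_simp
  ring

lemma weightedVolume_eq (hb : 0 ≤ b) (hrs : IsCoreRadius b rs) (hPx : 0 ≤ Px) (hPy : 0 ≤ Py)
    (hs : IsHeightFunction rs Px Py s) :
    weightedVolume b rs Px Py s = torusIntegral ![Px, Py] fun p => (s p ^ 3 - rs ^ 3) / 3 := by
  have hinner : ∀ p, ∫ r in rs..s p, r * volumeDensity (metric b) ![r, p 0, p 1]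
      = (s p ^ 3 - rs ^ 3) / 3 := fun p => by
    have hr : Set.EqOn (fun r => r * volumeDensity (metric b) ![r, p 0, p 1]) (fun r => r ^ 2)
        (Set.Ioo rs (s p)) := by
      intro r hr
      have hr₀ : 0 < r := hrs.1.1.trans hr.1
      have hf : profile b r ≠ 0 := (mul_pos (pow_pos hr₀ 2) (warp_pos hb hrs hr.1)).ne'
      simp only [volumeDensity_metric (p := ![r, p 0, p 1]) hr₀.le hf, Matrix.cons_val_zero, sq]
    rw [intervalIntegral.integral_congr_Ioo_of_le (hs.gt_core p).le hr, integral_pow]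
    norm_num
  have hsc := hs.smooth.continuous
  rw [weightedVolume, ← intervalIntegral_eq_torusIntegral hPx hPy (by fun_prop)]
  simp only [← hinner, Matrix.cons_val]

lemma weightedMeanCurvatureIntegral_eq (hb : 0 ≤ b) (hrs : IsCoreRadius b rs) (hPx : 0 ≤ Px)
    (hPy : 0 ≤ Py) (hs : IsHeightFunction rs Px Py s) :
    weightedMeanCurvatureIntegral b Px Py s
      = torusIntegral ![Px, Py] fun p => Jet.curvDensity (profile b) (jet s p) := by
  have hadm := hs.isAdmissible hb hrs
  have hcont : Continuous fun p => Jet.curvDensity (profile b) (jet s p) :=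
    continuous_iff_continuousAt.2 fun p =>
      (hadm p).contDiffAt_curvDensity.continuousAt.comp
        (contDiff_jet hs.smooth).continuous.continuousAt
  rw [weightedMeanCurvatureIntegral, ← intervalIntegral_eq_torusIntegral hPx hPy hcont]
  simp only [graphMeanCurvature_mul_areaDensity (hadm _) (congrFun (pd_comm hs.smooth 0 1) _)]

end AdSMelvinSpace

/-! ### The normal flow -/

section NormalFlow

variable {T₀ : EReal} {t : ℝ}

lemma convex_timeInterval : Convex ℝ (timeInterval T₀) :=
  Set.OrdConnected.convex ⟨fun _ hx _ hy _ hz =>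
    ⟨hx.1.trans hz.1, (EReal.coe_le_coe_iff.2 hz.2).trans_lt hy.2⟩⟩

lemma interior_timeInterval_nonempty (ht : t ∈ timeInterval T₀) :
    (interior (timeInterval T₀)).Nonempty := by
  obtain ⟨r, htr, hrT⟩ := EReal.lt_iff_exists_real_btwn.1 ht.2
  have hsub : Set.Ioo t r ⊆ timeInterval T₀ := fun x hx =>
    ⟨ht.1.trans hx.1.le, (EReal.coe_lt_coe_iff.2 hx.2).trans hrT⟩
  exact (Set.nonempty_Ioo.2 (EReal.coe_lt_coe_iff.1 htr)).mono (interior_maximal hsub isOpen_Ioo)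

variable {b rs Px Py : ℝ}

lemma IsHeightFunction.periodic_zsmul {s : (Fin 2 → ℝ) → ℝ} (hs : IsHeightFunction rs Px Py s)
    (m n : ℤ) : Function.Periodic s ![m * Px, n * Py] := by
  have hx : Function.Periodic s ![Px, 0] := hs.periodic_x
  have hy : Function.Periodic s ![0, Py] := hs.periodic_y
  simpa using (hx.zsmul m).add_period (hy.zsmul n)

variable {φ : ℝ → (Fin 2 → ℝ) → (Fin 3 → ℝ)} {s : ℝ → (Fin 2 → ℝ) → ℝ}

namespace IsNormalFlow

lemma radius_eq (hflow : IsNormalFlow b rs Px Py T₀ φ s) (ht : t ∈ timeInterval T₀)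
    (u : Fin 2 → ℝ) : φ t u 0 = s t ![φ t u 1, φ t u 2] := by
  have hmem : φ t u ∈ graphSet (s t) := by
    rw [← (hflow.embedded t ht).image_eq]
    exact ⟨u, 0, 0, by ext i; fin_cases i <;> simp⟩
  obtain ⟨p, hp⟩ := hmem
  have hp' : p = ![p 0, p 1] := by ext i; fin_cases i <;> rfl
  rw [← hp]
  exact congrArg (s t) hp'

lemma exists_eq_add (hflow : IsNormalFlow b rs Px Py T₀ φ s) (ht : t ∈ timeInterval T₀)
    (p : Fin 2 → ℝ) :
    ∃ (u : Fin 2 → ℝ) (m n : ℤ), p = ![φ t u 1, φ t u 2] + ![m * Px, n * Py] := by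
  have hmem : graphMap (s t) p ∈ {p | ∃ u, SpaceEq Px Py (φ t u) p} := by
    rw [(hflow.embedded t ht).image_eq]
    exact ⟨p, rfl⟩
  obtain ⟨u, m, n, hu⟩ := hmem
  refine ⟨u, m, n, ?_⟩
  ext i
  fin_cases i
  · simpa [graphMap] using congrFun hu 1
  · simpa [graphMap] using congrFun hu 2

/-- Differentiating `r = s(t, x, y)` along a flow line `φ(·, u)` shows that `r ∂s/∂t` is the
pairing of `ν` with `d(r - s)`. -/
lemma hasDerivWithinAt_height_of_mem (hflow : IsNormalFlow b rs Px Py T₀ φ s) (hb : 0 ≤ b)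
    (hrs : IsCoreRadius b rs) (ht : t ∈ timeInterval T₀) (u : Fin 2 → ℝ) :
    HasDerivWithinAt (fun τ => s τ ![φ t u 1, φ t u 2])
      (Jet.speed (profile b) (jet (s t) ![φ t u 1, φ t u 2])) (timeInterval T₀) t := by
  set p : Fin 2 → ℝ := ![φ t u 1, φ t u 2] with hp
  set r : ℝ := φ t u 0
  set ν := unitNormal b (s t) p
  have hadm := (hflow.height t ht).isAdmissible hb hrs p
  have hrs' : r = s t p := hflow.radius_eq ht u
  have hφ := hasDerivWithinAt_pi.1 (hflow.flow t ht u)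
  have hγ : HasDerivWithinAt (fun τ => ![φ τ u 1, φ τ u 2]) ![r⁻¹ * ν 1, r⁻¹ * ν 2]
      (timeInterval T₀) t := by
    refine hasDerivWithinAt_pi.2 fun i => ?_
    fin_cases i
    exacts [hφ 1, hφ 2]
  have hsmooth : IsSmoothFamily (timeInterval T₀) s := hflow.smooth_height
  have hchain := hsmooth.hasDerivWithinAt_comp ht hγ
  have hradius : HasDerivWithinAt (fun τ => s τ ![φ τ u 1, φ τ u 2]) (r⁻¹ * ν 0)
      (timeInterval T₀) t :=
    (hφ 0).congr (fun τ hτ => (hflow.radius_eq hτ u).symm) (hflow.radius_eq ht u).symm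
  have hunique := uniqueDiffOn_convex convex_timeInterval (interior_timeInterval_nonempty ht)
  have heq := (hunique t ht).eq_deriv _ hchain hradius
  have hpair := unitNormal_dotProduct_conormal hadm
  refine (hsmooth.hasDerivWithinAt ht p).congr_deriv ?_
  have hs₀ : s t p ≠ 0 := hadm.s_pos.ne'
  rw [fderiv_eq_sum_pd, ← hp, ← eq_sub_iff_add_eq, Fin.sum_univ_two] at heq
  rw [heq, ← mul_right_inj' hs₀, ← hpair, hrs', dotProduct, Fin.sum_univ_three]
  simp only [conormal, Matrix.cons_val]
  field_simp
  ring

lemma hasDerivWithinAt_height (hflow : IsNormalFlow b rs Px Py T₀ φ s) (hb : 0 ≤ b)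
    (hrs : IsCoreRadius b rs) (ht : t ∈ timeInterval T₀) (p : Fin 2 → ℝ) :
    HasDerivWithinAt (fun τ => s τ p) (Jet.speed (profile b) (jet (s t) p))
      (timeInterval T₀) t := by
  obtain ⟨u, m, n, rfl⟩ := hflow.exists_eq_add ht p
  have hper : ∀ τ ∈ timeInterval T₀, Function.Periodic (s τ) ![m * Px, n * Py] := fun τ hτ =>
    (hflow.height τ hτ).periodic_zsmul m n
  rw [periodic_jet (hper t ht)]
  exact (hflow.hasDerivWithinAt_height_of_mem hb hrs ht u).congr (fun τ hτ => hper τ hτ _)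
    (hper t ht _)

end IsNormalFlow

end NormalFlow

/-! ### The derivative of `Q` -/

section Monotonicity

/-- The density of `-dQ/dt` along the flow. -/
def defect (b : ℝ) (j : Jet) : ℝ :=
  2 * ((warp b j.s + b / j.s ^ 4) * j.p ^ 2 + j.q ^ 2) * Jet.speed (profile b) j
    / (j.s ^ 2 * Jet.speedSq (profile b) j)

variable {b : ℝ} {j : Jet}

lemma defect_nonneg (hb : 0 ≤ b) (hj : Jet.IsAdmissible (profile b) j) : 0 ≤ defect b j := by
  have hF : 0 < warp b j.s := pos_of_mul_pos_right hj.profile_pos (sq_nonneg _)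
  have hs := hj.s_pos
  have hu := hj.speed_pos
  have hM := hj.speedSq_pos
  unfold defect
  positivity

lemma defect_eq_zero_iff (hb : 0 ≤ b) (hj : Jet.IsAdmissible (profile b) j) :
    defect b j = 0 ↔ j.p = 0 ∧ j.q = 0 := by
  have hs := hj.s_pos
  have hF : 0 < warp b j.s := pos_of_mul_pos_right hj.profile_pos (sq_nonneg _)
  have hF' : 0 < warp b j.s + b / j.s ^ 4 := by positivity
  have hden : j.s ^ 2 * Jet.speedSq (profile b) j ≠ 0 :=
    (mul_pos (pow_pos hs 2) hj.speedSq_pos).ne'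
  rw [defect, div_eq_zero_iff, or_iff_left hden, mul_eq_zero, or_iff_left hj.speed_pos.ne',
    mul_eq_zero, or_iff_right two_ne_zero,
    add_eq_zero_iff_of_nonneg (by positivity) (by positivity), mul_eq_zero,
    or_iff_right hF'.ne', sq_eq_zero_iff, sq_eq_zero_iff]

lemma contDiffAt_defect (hj : Jet.IsAdmissible (profile b) j) : ContDiffAt ℝ ∞ (defect b) j := by
  have hu := hj.contDiffAt_speed
  have hM := hj.contDiffAt_speedSq
  have hs := hj.s_pos.ne'
  have hM₀ := hj.speedSq_pos.ne'
  unfold defect warp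
  fun_prop (disch := first | assumption | positivity)

lemma reaction_profile (hs : j.s ≠ 0) :
    Jet.reaction (profile b) j = 6 * (j.s ^ 2 * Jet.speed (profile b) j) - defect b j := by
  have hvolume : 2 * j.s * deriv (profile b) j.s + j.s ^ 2 * deriv (deriv (profile b)) j.s / 2
      + profile b j.s = 6 * j.s ^ 2 := by
    rw [deriv_profile b hs, deriv_deriv_profile b hs, profile, warp]
    field_simp
    ring
  have hslope : deriv (deriv (profile b)) j.s / 2 - 3 * profile b j.s / j.s ^ 2
      = -(2 * (warp b j.s + b / j.s ^ 4)) := by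
    rw [deriv_deriv_profile b hs, profile, warp]
    field_simp
    ring
  rw [Jet.reaction, hvolume, hslope, defect]
  ring

variable {s : (Fin 2 → ℝ) → ℝ}

lemma isCoordinateTorus_iff (hs : Differentiable ℝ s) :
    IsCoordinateTorus s ↔ ∀ p, pd 0 s p = 0 ∧ pd 1 s p = 0 := by
  constructor
  · rintro ⟨c, hc⟩ p
    rw [show s = fun _ => c from funext hc]
    exact ⟨pd_const _ _ _, pd_const _ _ _⟩
  · intro h
    refine ⟨s 0, fun p => is_const_of_fderiv_eq_zero (𝕜 := ℝ) hs (fun q => ?_) p 0⟩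
    ext v
    simp [fderiv_eq_sum_pd, h q]

variable {rs Px Py : ℝ}

lemma IsHeightFunction.periodic_single (hs : IsHeightFunction rs Px Py s) (i : Fin 2) :
    Function.Periodic s (Pi.single i (![Px, Py] i)) := by
  fin_cases i
  · have h := hs.periodic_zsmul 1 0
    rwa [show ![((1 : ℤ) : ℝ) * Px, ((0 : ℤ) : ℝ) * Py] = Pi.single 0 Px by
      ext i; fin_cases i <;> simp] at h
  · have h := hs.periodic_zsmul 0 1
    rwa [show ![((0 : ℤ) : ℝ) * Px, ((1 : ℤ) : ℝ) * Py] = Pi.single 1 Py by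
      ext i; fin_cases i <;> simp] at h

lemma torusIntegral_defect_nonneg (hb : 0 ≤ b)
    (hadm : ∀ p, Jet.IsAdmissible (profile b) (jet s p)) (P : Fin 2 → ℝ) :
    0 ≤ torusIntegral P fun p => defect b (jet s p) :=
  MeasureTheory.integral_nonneg fun p => defect_nonneg hb (hadm p)

lemma torusIntegral_defect_eq_zero_iff (hb : 0 ≤ b) (hrs : IsCoreRadius b rs) (hPx : 0 < Px)
    (hPy : 0 < Py) (hs : IsHeightFunction rs Px Py s) :
    torusIntegral ![Px, Py] (fun p => defect b (jet s p)) = 0 ↔ IsCoordinateTorus s := by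
  have hadm := hs.isAdmissible hb hrs
  have hP : ∀ i, 0 < ![Px, Py] i := by simp [Fin.forall_fin_two, hPx, hPy]
  rw [isCoordinateTorus_iff (hs.smooth.differentiable (by simp)),
    torusIntegral_eq_zero_iff hP
      (contDiff_comp_jet hs.smooth fun p => contDiffAt_defect (hadm p)).continuous
      (fun p => defect_nonneg hb (hadm p))
      fun i => (periodic_jet (hs.periodic_single i)).comp (defect b)]
  exact forall_congr' fun p => defect_eq_zero_iff hb (hadm p)

lemma torusIntegral_evolution (hb : 0 ≤ b) (hrs : IsCoreRadius b rs) (hPx : 0 ≤ Px)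
    (hPy : 0 ≤ Py) (hs : IsHeightFunction rs Px Py s) :
    torusIntegral ![Px, Py] (fun p =>
        pd 0 (fun q => Jet.fluxX (profile b) (jet s q)) p
          + pd 1 (fun q => Jet.fluxY (profile b) (jet s q)) p
          + Jet.reaction (profile b) (jet s p))
      - 6 * torusIntegral ![Px, Py] (fun p => s p ^ 2 * Jet.speed (profile b) (jet s p))
      = -torusIntegral ![Px, Py] fun p => defect b (jet s p) := by
  have hadm := hs.isAdmissible hb hrs
  have hX : ContDiff ℝ ∞ fun q => Jet.fluxX (profile b) (jet s q) :=
    contDiff_comp_jet hs.smooth fun q => (hadm q).contDiffAt_fluxX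
  have hY : ContDiff ℝ ∞ fun q => Jet.fluxY (profile b) (jet s q) :=
    contDiff_comp_jet hs.smooth fun q => (hadm q).contDiffAt_fluxY
  have hu : ContDiff ℝ ∞ fun q => Jet.speed (profile b) (jet s q) :=
    contDiff_comp_jet hs.smooth fun q => (hadm q).contDiffAt_speed
  have hE : ContDiff ℝ ∞ fun q => defect b (jet s q) :=
    contDiff_comp_jet hs.smooth fun q => contDiffAt_defect (hadm q)
  have hper := fun i => periodic_jet (hs.periodic_single i)
  have hdiv := torusIntegral_pd_zero_add_pd_one hPx hPy hX hY
    ((hper 0).comp (Jet.fluxX (profile b))) ((hper 1).comp (Jet.fluxY (profile b)))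
  have hD : Continuous fun p => pd 0 (fun q => Jet.fluxX (profile b) (jet s q)) p
      + pd 1 (fun q => Jet.fluxY (profile b) (jet s q)) p :=
    (contDiff_pd hX 0).continuous.add (contDiff_pd hY 1).continuous
  have hV : Continuous fun p => 6 * (s p ^ 2 * Jet.speed (profile b) (jet s p)) :=
    ((hs.smooth.continuous.pow 2).mul hu.continuous).const_mul 6
  have hreaction : ∀ p, Jet.reaction (profile b) (jet s p)
      = 6 * (s p ^ 2 * Jet.speed (profile b) (jet s p)) - defect b (jet s p) := fun p =>
    reaction_profile (hadm p).s_pos.ne'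
  simp only [hreaction]
  rw [torusIntegral_add hD (hV.fun_sub hE.continuous), hdiv,
    torusIntegral_sub hV hE.continuous, torusIntegral_const_mul]
  ring

theorem IsNormalFlow.hasDerivWithinAt_Q {T₀ : EReal} {φ : ℝ → (Fin 2 → ℝ) → (Fin 3 → ℝ)}
    {s : ℝ → (Fin 2 → ℝ) → ℝ} {t : ℝ} (hflow : IsNormalFlow b rs Px Py T₀ φ s) (hb : 0 ≤ b)
    (hrs : IsCoreRadius b rs) (hPx : 0 ≤ Px) (hPy : 0 ≤ Py) (ht : t ∈ timeInterval T₀) :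
    HasDerivWithinAt (fun τ => Q b rs Px Py (s τ))
      (-torusIntegral ![Px, Py] fun p => defect b (jet (s t) p)) (timeInterval T₀) t := by
  have hconv : Convex ℝ (timeInterval T₀) := convex_timeInterval
  have hint := interior_timeInterval_nonempty ht
  have hsmooth : IsSmoothFamily (timeInterval T₀) s := hflow.smooth_height
  have hadm : ∀ τ ∈ timeInterval T₀, ∀ p, Jet.IsAdmissible (profile b) (jet (s τ) p) :=
    fun τ hτ => (hflow.height τ hτ).isAdmissible hb hrs
  have hheight := hflow.hasDerivWithinAt_height hb hrs ht
  have hcurv : HasDerivWithinAt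
      (fun τ => torusIntegral ![Px, Py] fun p => Jet.curvDensity (profile b) (jet (s τ) p)) _
      (timeInterval T₀) t :=
    ((hsmooth.jet hconv hint).comp fun τ hτ p =>
      (hadm τ hτ p).contDiffAt_curvDensity).hasDerivWithinAt_torusIntegral hconv hint ht
        (hasDerivWithinAt_curvDensity_jet hconv hint hsmooth ht (hadm t ht) hheight)
  have hvol : HasDerivWithinAt
      (fun τ => torusIntegral ![Px, Py] fun p => (s τ p ^ 3 - rs ^ 3) / 3)
      (torusIntegral ![Px, Py] fun p => s t p ^ 2 * Jet.speed (profile b) (jet (s t) p))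
      (timeInterval T₀) t := by
    refine (hsmooth.comp (φ := fun r => (r ^ 3 - rs ^ 3) / 3) fun τ _ p => by
      fun_prop).hasDerivWithinAt_torusIntegral hconv hint ht fun p => ?_
    refine ((((hheight p).fun_pow 3).sub_const _).div_const 3).congr_deriv ?_
    norm_num
    ring
  refine ((hcurv.sub (hvol.const_mul 6)).congr_deriv
    (torusIntegral_evolution hb hrs hPx hPy (hflow.height t ht))).congr_of_mem (fun τ hτ => ?_) ht
  rw [Q, weightedMeanCurvatureIntegral_eq hb hrs hPx hPy (hflow.height τ hτ),
    weightedVolume_eq hb hrs hPx hPy (hflow.height τ hτ)]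
  rfl

end Monotonicity

end AdSMelvin
end

theorem proposition4p1_general {b rs Px Py : ℝ} (hb : 0 ≤ b) (hrs : AdSMelvin.IsCoreRadius b rs)
    (hPx : 0 < Px) (hPy : 0 < Py) {T₀ : EReal} {φ : ℝ → (Fin 2 → ℝ) → (Fin 3 → ℝ)}
    {s : ℝ → (Fin 2 → ℝ) → ℝ} (hflow : AdSMelvin.IsNormalFlow b rs Px Py T₀ φ s) {t : ℝ}
    (ht : t ∈ AdSMelvin.timeInterval T₀) :
    ∃ Q' : ℝ,
      HasDerivWithinAt (fun τ => AdSMelvin.Q b rs Px Py (s τ)) Q' (AdSMelvin.timeInterval T₀) t ∧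
      Q' ≤ 0 ∧ (Q' = 0 ↔ AdSMelvin.IsCoordinateTorus (s t)) := by
  have hs := hflow.height t ht
  refine ⟨_, hflow.hasDerivWithinAt_Q hb hrs hPx.le hPy.le ht, ?_, ?_⟩
  · exact neg_nonpos.2 (AdSMelvin.torusIntegral_defect_nonneg hb (hs.isAdmissible hb hrs) _)
  · exact neg_eq_zero.trans (AdSMelvin.torusIntegral_defect_eq_zero_iff hb hrs hPx hPy hs)

theorem proposition4p1 (b rs Px : ℝ) (hb : 0 < b) (hrs : AdSMelvin.IsCoreRadius b rs)
    (hPx : 0 < Px) (T₀ : EReal) (φ : ℝ → (Fin 2 → ℝ) → (Fin 3 → ℝ))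
    (s : ℝ → (Fin 2 → ℝ) → ℝ)
    (hflow : AdSMelvin.IsNormalFlow b rs Px (AdSMelvin.periodY b rs) T₀ φ s)
    (t : ℝ) (ht : t ∈ AdSMelvin.timeInterval T₀) :
    ∃ Q' : ℝ,
      HasDerivWithinAt (fun τ => AdSMelvin.Q b rs Px (AdSMelvin.periodY b rs) (s τ)) Q'
        (AdSMelvin.timeInterval T₀) t ∧
      Q' ≤ 0 ∧ (Q' = 0 ↔ AdSMelvin.IsCoordinateTorus (s t)) := by
  exact proposition4p1_general hb.le hrs hPx (AdSMelvin.periodY_pos hb.le hrs) hflow ht
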